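/- Fix a real constant $\sigma$. For $\nu>0$ and $x>0$ let $$I_s^\nu f(x)=\frac1{\Gamma(\nu)}\int_0^x (x-\tau)^{\nu-1}e^{-\sigma(x-\tau)}f(\tau)\,d\tau ,$$ the integral being understood as a Hadamard finite part if $f$ has a non-integrable power singularity at $0$; let $I_s^0f=f$; and for $\alpha<0$ let $$I_s^{\alpha}f=D_s^{-\alpha}f=\Big(\frac{d}{dx}+\sigma\Big)^{m}\big[I_s^{m+\alpha}f\big],$$ where $m$ is the smallest integer exceeding $-\alpha$. Given a sequence $(\omega_j)_{j\ge0}$ of complex numbers and a step size $h>0$, put $\kappa_j=e^{-j\sigma h}\omega_j$ and, at $x=nh$, $$E_{s,h}^\alpha f(x)=h^\alpha\sum_{j=0}^n\kappa_{n-j}f(jh)-I_s^\alpha f(x).$$ The convolution quadrature $\kappa$ is called convergent of order $p\in\{0,1,2,\dots\}$ (to $I_s^\alpha$) if, as $h=1/n\to0$, $$E_{s,h}^\alpha[e^{-\sigma t}t^{z-1}](1)=O(h^{z})+O(h^p)\quad\text{for all } z\in\mathbb C,\ z\ne0,-1,-2,\dots$$ (in these formulas and below, $0^{0}=1$ and $0^{z}=0$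 for $z\neq0$, i.e. the value at $0$ is discarded where the power function is singular). **Theorem.** Let $\alpha\in\mathbb R$, $p\in\{0,1,2,\dots\}$ and $\beta\in\mathbb C$, where $\beta\ne0,-1,-2,\dots$ if $\alpha\ge0$, and $\Re\beta>\lceil-\alpha\rceil$ if $\alpha<0$. There are integers $N,r\ge0$, depending only on $\alpha,\beta,p$, such that for every real $\sigma$ and every sequence $\omega$ for which $\kappa$ is convergent of order $p$ to $I_s^\alpha$ there exist starting weights $\kappa_{n,j}=\kappa_{n,j}(h)$ ($h>0$, $n\ge1$, $1\le j\le r$) with the following properties. (a) For all $h>0$ and $n\ge1$ they solve the Vandermonde-type system $$\sum_{j=1}^r\kappa_{n,j}e^{-\sigma jh}j^{q+\beta-1}=\frac{\Gamma(q+\beta)}{\Gamma(\alpha+q+\beta)}e^{-\sigma nh}n^{q+\alpha+\beta-1}-\sum_{j=0}^n\kappa_{n-j}e^{-\sigma jh}j^{q+\beta-1},\qquad q=0,1,\dots,r-1,$$ where $1/\Gamma=0$ at the poles of $\Gamma$. (b) For every $f(x)=x^{\beta-1}g(x)$ with $g:[0,\infty)\to\mathbb C$ that is $N$ times continuously differentiable,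 $I_s^\alpha f$ exists on $(0,\infty)$, and the corrected quadrature $$I_{s,h}^\alpha f(x)=h^\alpha\sum_{j=0}^n\kappa_{n-j}f(jh)+h^\alpha\sum_{j=1}^r\kappa_{n,j}f(jh)\qquad(x=nh)$$ satisfies $$I_{s,h}^\alpha f(x)-I_s^\alpha f(x)=O(h^p)\quad\text{uniformly for bounded }x:$$ for every $X>0$ there is a constant $C$ such that the error is at most $Ch^p$ in absolute value for all $h>0$ and $n\ge1$ with $x=nh\le X$. -/

import Mathlib

open Filter Topology MeasureTheory

noncomputable section

namespace SubstantialCalculus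

/-- `L` is the Hadamard finite part of `Φ ε` as `ε → 0+`: up to finitely many terms `c ε ^ l` with
exponents `l ≠ 0`, which are discarded, `Φ ε` tends to `L`. -/
def HasFinitePart (Φ : ℝ → ℂ) (L : ℂ) : Prop :=
  ∃ (s : Finset ℂ) (c : ℂ → ℂ), (0 : ℂ) ∉ s ∧
    Tendsto (fun ε : ℝ => Φ ε - ∑ l ∈ s, c l * (ε : ℂ) ^ l) (𝓝[>] 0) (𝓝 L)

/-- `L` is the finite part of `∫_0^x φ`; the function `φ` may have a non-integrable power
singularity at `0`. If `φ` is integrable on `(0, x)`, this is the ordinary integral, see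
`hasFPIntegral_of_intervalIntegrable`. -/
def HasFPIntegral (φ : ℝ → ℂ) (x : ℝ) (L : ℂ) : Prop :=
  (∀ ε ∈ Set.Ioo 0 x, IntervalIntegrable φ volume ε x) ∧
    HasFinitePart (fun ε : ℝ => ∫ τ in ε..x, φ τ) L

open Classical in
/-- The finite part of `∫_0^x φ` (and `0` if there is none). -/
def fpIntegral (φ : ℝ → ℂ) (x : ℝ) : ℂ :=
  if h : ∃ L, HasFPIntegral φ x L then h.choose else 0

/-- The integrand `(x - τ)^(ν-1) e^(-σ(x-τ)) f(τ)` of the fractional substantial integral. -/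
def substKernel (σ ν : ℝ) (f : ℝ → ℂ) (x : ℝ) : ℝ → ℂ :=
  fun τ => (((x - τ) ^ (ν - 1) * Real.exp (-σ * (x - τ)) : ℝ) : ℂ) * f τ

/-- The fractional substantial integral of order `ν > 0` with lower terminal `0`. -/
def substIntegral (σ ν : ℝ) (f : ℝ → ℂ) (x : ℝ) : ℂ :=
  ((1 / Real.Gamma ν : ℝ) : ℂ) * fpIntegral (substKernel σ ν f x) x

/-- The operator `D_s = d/dx + σ`. -/
def substD (σ : ℝ) (u : ℝ → ℂ) : ℝ → ℂ := fun x => deriv u x + (σ : ℂ) * u x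

/-- The smallest integer that exceeds `μ` (for `μ ≥ 0`). -/
def derivOrder (μ : ℝ) : ℕ := ⌊μ⌋₊ + 1

/-- The fractional substantial derivative of order `μ > 0`: `D_s^m [I_s^(m-μ) f]`, where `m` is the
smallest integer that exceeds `μ`. -/
def substDeriv (σ μ : ℝ) (f : ℝ → ℂ) : ℝ → ℂ :=
  (substD σ)^[derivOrder μ] (substIntegral σ (derivOrder μ - μ) f)

/-- The operator `I_s^α` for real `α`: the substantial integral for `α > 0`, the identity for
`α = 0`, the substantial derivative of order `-α` for `α < 0`. -/
def substOp (σ α : ℝ) (f : ℝ → ℂ) : ℝ → ℂ :=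
  if 0 < α then substIntegral σ α f else if α = 0 then f else substDeriv σ (-α) f

/-- `I_s^α f` exists on `(0, ∞)`: the (finite part) integrals that define it exist and, for `α < 0`,
the function to which `D_s^m` is applied is `m` times continuously differentiable. -/
def SubstOpExists (σ α : ℝ) (f : ℝ → ℂ) : Prop :=
  (0 < α → ∀ x : ℝ, 0 < x → ∃ L, HasFPIntegral (substKernel σ α f x) x L) ∧
  (α < 0 →
    (∀ x : ℝ, 0 < x → ∃ L, HasFPIntegral (substKernel σ (derivOrder (-α) - -α) f x) x L) ∧
    ContDiffOn ℝ (derivOrder (-α)) (substIntegral σ (derivOrder (-α) - -α) f) (Set.Ioi 0))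

/-- The convolution quadrature weights `κ_j = e^(-jσh) ω_j`. -/
def convWeight (σ : ℝ) (ω : ℕ → ℂ) (h : ℝ) (j : ℕ) : ℂ :=
  (Real.exp (-(j * σ * h)) : ℂ) * ω j

/-- The convolution quadrature `h^α ∑_{j=0}^n κ_{n-j} f(jh)` at `x = nh`. -/
def convQuad (σ α : ℝ) (ω : ℕ → ℂ) (h : ℝ) (n : ℕ) (f : ℝ → ℂ) : ℂ :=
  ((h ^ α : ℝ) : ℂ) * ∑ j ∈ Finset.range (n + 1), convWeight σ ω h (n - j) * f (j * h)

/-- The convolution quadrature error `E_{s,h}^α f` at `x = nh`. -/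
def quadError (σ α : ℝ) (ω : ℕ → ℂ) (h : ℝ) (n : ℕ) (f : ℝ → ℂ) : ℂ :=
  convQuad σ α ω h n f - substOp σ α f (n * h)

/-- The convolution quadrature `κ_j = e^(-jσh) ω_j` is convergent of order `p` to `I_s^α`: its error
for `e^(-σt) t^(β-1)` at `x = 1 = nh` is `O(h^β) + O(h^p)`, for every complex `β ≠ 0, -1, -2, …`.
Here `0 ^ 0 = 1`, and `0 ^ z = 0` for all other exponents `z`, so that the value at `t = 0` is
discarded where the power function is singular. -/
def IsConvergentOfOrder (σ α : ℝ) (ω : ℕ → ℂ) (p : ℕ) : Prop :=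
  ∀ β : ℂ, (∀ k : ℕ, β ≠ -(k : ℂ)) →
    (fun n : ℕ => quadError σ α ω (1 / (n : ℝ)) n
        (fun t => (Real.exp (-σ * t) : ℂ) * (t : ℂ) ^ (β - 1)))
      =O[atTop] fun n : ℕ => (1 / (n : ℝ)) ^ β.re + (1 / (n : ℝ)) ^ p

/-- The corrected quadrature `h^α ∑_{j=0}^n κ_{n-j} f(jh) + h^α ∑_{j=1}^r κ_{n,j} f(jh)` at
`x = nh`; `w n j` stands for the starting weight `κ_{n,j}` at step size `h`. -/
def correctedQuad (σ α : ℝ) (ω : ℕ → ℂ) (r : ℕ) (w : ℕ → ℕ → ℂ) (h : ℝ) (n : ℕ)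
    (f : ℝ → ℂ) : ℂ :=
  convQuad σ α ω h n f + ((h ^ α : ℝ) : ℂ) * ∑ j ∈ Finset.Icc 1 r, w n j * f (j * h)

/-- The Vandermonde type system for the starting weights `κ_{n,1}, …, κ_{n,r}`. The quotient
`Γ(q+β)/Γ(α+q+β)` is `0` where the denominator has a pole, in accordance with `1/Γ = 0` there. -/
def StartingSystem (σ α : ℝ) (β : ℂ) (ω : ℕ → ℂ) (r : ℕ) (w : ℕ → ℕ → ℂ) (h : ℝ) (n : ℕ) : Prop :=
  ∀ q < r,
    ∑ j ∈ Finset.Icc 1 r, w n j * (Real.exp (-σ * (j * h)) : ℂ) * (j : ℂ) ^ ((q : ℂ) + β - 1) =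
      Complex.Gamma (q + β) / Complex.Gamma (α + q + β) *
          (Real.exp (-σ * (n * h)) : ℂ) * (n : ℂ) ^ ((q : ℂ) + α + β - 1) -
        ∑ j ∈ Finset.range (n + 1),
          convWeight σ ω h (n - j) * (Real.exp (-σ * (j * h)) : ℂ) * (j : ℂ) ^ ((q : ℂ) + β - 1)

/-- A finite sum of powers with non-zero exponents has no other limit at `0+` than `0`. -/
theorem eq_zero_of_tendsto_sum_cpow (s : Finset ℂ) : ∀ (c : ℂ → ℂ) (L : ℂ), (0 : ℂ) ∉ s →
    Tendsto (fun ε : ℝ => ∑ l ∈ s, c l * (ε : ℂ) ^ l) (𝓝[>] 0) (𝓝 L) → L = 0 := by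
  classical
  induction s using Finset.induction_on with
  | empty =>
    intro c L _ h
    simp only [Finset.sum_empty] at h
    exact tendsto_nhds_unique h tendsto_const_nhds
  | insert μ s hμ ih =>
    intro c L h0 h
    simp only [Finset.mem_insert, not_or] at h0
    obtain ⟨h0, h0s⟩ := h0
    have hμ0 : μ ≠ 0 := fun e => h0 e.symm
    set a : ℝ := Real.exp (-(1 / (‖μ‖ + 1))) with ha
    have hapos : 0 < a := Real.exp_pos _
    have hane : (a : ℂ) ^ μ ≠ 1 := by
      rw [Complex.cpow_def_of_ne_zero (by exact_mod_cast hapos.ne'), ← Complex.ofReal_log hapos.le,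
        ha, Real.log_exp]
      intro e
      obtain ⟨n, hn⟩ := Complex.exp_eq_one_iff.1 e
      have hlt : ‖((-(1 / (‖μ‖ + 1)) : ℝ) : ℂ) * μ‖ < 1 := by
        rw [norm_mul, Complex.norm_real, norm_neg, Real.norm_of_nonneg (by positivity),
          one_div, inv_mul_lt_iff₀ (by positivity)]
        linarith
      rw [hn] at hlt
      have hn0 : n = 0 := by
        by_contra hne
        have h1 : (1 : ℝ) ≤ |(n : ℝ)| := by exact_mod_cast Int.one_le_abs hne
        have h2 : ‖(n : ℂ) * (2 * Real.pi * Complex.I)‖ = |(n : ℝ)| * (2 * Real.pi) := by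
          simp [abs_of_pos Real.pi_pos]
        rw [h2] at hlt
        nlinarith [Real.pi_gt_three]
      rw [hn0] at hn
      have h3 : ((-(1 / (‖μ‖ + 1)) : ℝ) : ℂ) ≠ 0 := by
        have : (0 : ℝ) < 1 / (‖μ‖ + 1) := by positivity
        exact_mod_cast (neg_lt_zero.2 this).ne
      simp only [Int.cast_zero, zero_mul] at hn
      exact (mul_ne_zero h3 hμ0) hn
    have hscale : Tendsto (fun ε : ℝ => a * ε) (𝓝[>] 0) (𝓝[>] 0) := by
      refine tendsto_nhdsWithin_of_tendsto_nhds_of_eventually_within _ ?_ ?_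
      · have : Tendsto (fun ε : ℝ => a * ε) (𝓝 0) (𝓝 (a * 0)) :=
          (continuous_const.mul continuous_id).tendsto 0
        rw [mul_zero] at this
        exact this.mono_left nhdsWithin_le_nhds
      · filter_upwards [self_mem_nhdsWithin] with ε hε
        exact mul_pos hapos hε
    have key := (h.comp hscale).sub (h.const_mul ((a : ℂ) ^ μ))
    have hL : L - (a : ℂ) ^ μ * L = 0 := by
      refine ih (fun l => c l * ((a : ℂ) ^ l - (a : ℂ) ^ μ)) _ h0s (key.congr' ?_)
      filter_upwards [self_mem_nhdsWithin] with ε hε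
      have hm : ∀ l : ℂ, ((a * ε : ℝ) : ℂ) ^ l = (a : ℂ) ^ l * (ε : ℂ) ^ l := fun l => by
        rw [Complex.ofReal_mul, Complex.mul_cpow_ofReal_nonneg hapos.le (le_of_lt hε)]
      simp only [Function.comp, Finset.sum_insert hμ, hm, mul_add, Finset.mul_sum]
      rw [show ∀ A B C D : ℂ, A + B - (C + D) = (A - C) + (B - D) from fun _ _ _ _ => by ring,
        ← Finset.sum_sub_distrib]
      rw [show c μ * ((a : ℂ) ^ μ * (ε : ℂ) ^ μ) - (a : ℂ) ^ μ * (c μ * (ε : ℂ) ^ μ) = 0 by ring,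
        zero_add]
      exact Finset.sum_congr rfl fun l _ => by ring
    have : (1 - (a : ℂ) ^ μ) * L = 0 := by rw [← hL]; ring
    rcases mul_eq_zero.1 this with h1 | h1
    · exact absurd (sub_eq_zero.1 h1).symm hane
    · exact h1

theorem HasFinitePart.unique {Φ : ℝ → ℂ} {L M : ℂ} (hL : HasFinitePart Φ L)
    (hM : HasFinitePart Φ M) : L = M := by
  classical
  obtain ⟨s, c, hs, h⟩ := hL
  obtain ⟨t, d, ht, h'⟩ := hM
  have key := h'.sub h
  have h0 : (0 : ℂ) ∉ s ∪ t := by simp [hs, ht]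
  have := eq_zero_of_tendsto_sum_cpow (s ∪ t)
    (fun l => (if l ∈ s then c l else 0) - (if l ∈ t then d l else 0)) (M - L) h0
    (key.congr fun ε => by
      simp only [sub_mul, Finset.sum_sub_distrib, ite_mul, zero_mul, Finset.sum_ite_mem,
        Finset.union_inter_cancel_left, Finset.union_inter_cancel_right]
      ring)
  exact (sub_eq_zero.1 this).symm

theorem HasFPIntegral.fpIntegral_eq {φ : ℝ → ℂ} {x : ℝ} {L : ℂ} (h : HasFPIntegral φ x L) :
    fpIntegral φ x = L := by
  have hex : ∃ L, HasFPIntegral φ x L := ⟨L, h⟩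
  rw [fpIntegral, dif_pos hex]
  exact hex.choose_spec.2.unique h.2

theorem hasFPIntegral_of_intervalIntegrable {φ : ℝ → ℂ} {x : ℝ} (hx : 0 < x)
    (h : IntervalIntegrable φ volume 0 x) : HasFPIntegral φ x (∫ τ in (0 : ℝ)..x, φ τ) := by
  refine ⟨fun ε hε => h.mono_set ?_, ∅, 0, by simp, ?_⟩
  · rw [Set.uIcc_of_le hε.2.le, Set.uIcc_of_le hx.le]
    exact Set.Icc_subset_Icc_left hε.1.le
  · simp only [Finset.sum_empty, sub_zero]
    have hc : ContinuousOn (fun ε => ∫ τ in ε..x, φ τ) (Set.uIcc 0 x) := by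
      have h1 := intervalIntegral.continuousOn_primitive_interval'
        (a := x) (b₁ := 0) (b₂ := x) (f := φ) (μ := volume) h Set.right_mem_uIcc
      refine h1.neg.congr fun ε _ => ?_
      simp only [Pi.neg_apply]
      exact intervalIntegral.integral_symm _ _
    have h2 := hc 0 Set.left_mem_uIcc
    rw [Set.uIcc_of_le hx.le] at h2
    refine h2.tendsto.mono_left ?_
    rw [← nhdsWithin_Ioc_eq_nhdsGT hx]
    exact nhdsWithin_mono _ Set.Ioc_subset_Icc_self

end SubstantialCalculus

end

open SubstantialCalculus

namespace SubstantialCalculus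

/-! ### Finite parts -/

/-! The factors `e^(-(n-j)σh)` and `e^(-σjh)` multiply to `e^(-σnh)`, so after writing `f = e^(-σx)
u` everything happens at `σ = 0`. A Taylor expansion of `e^(σx) g` at `0` gives `u = ∑_{q<r} c_q
x^(q+β-1) + F`. Here `F` is `x^(β-1)` times a Taylor remainder; extended by zero to the negative
axis it is `C^(K+1)` on the whole line when `r` is large. The corrected error is linear, so the two
pieces can be treated separately.

Powers: the starting weights are chosen so that each of the `r` powers is integrated exactly. The
system is solvable because its matrix is a Vandermonde matrix times an invertible diagonal one
(`exists_inverse_power_matrix`). The exact values of `I_s^α` come from the finite-part Beta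
integral, through `substOp_eq`.

Smooth part, convolution sum: since `F` vanishes to the left of `0`, Taylor's formula writes the
error as an integral of `F^(K+1)` against the error for truncated powers `x_+^K/K!`, the Peano
kernel. Between grid points this kernel is the error for a shifted monomial. Differentiation in the
shift lowers the degree, so the hypothesis at the integer exponents `1, …, K+1` controls it. This
gives `O(h^p)` in `exists_norm_rpow_mul_sum_sub_rlIntegral_le`.

Smooth part, starting weights: applied at `h = 1/n`, the hypothesis bounds the unscaled power errors
(`exists_norm_powerError_le`), hence the weights, by a power of `n` that grows with `r`. But `F(jh)`
is small of an order that grows with `r` at the same rate, and with `n ≤ X/h` the product is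
`O(h^(p+1))` (`exists_norm_rpow_mul_sum_weights_le`). -/

theorem HasFinitePart.congr {Φ Ψ : ℝ → ℂ} {L : ℂ} (h : HasFinitePart Φ L)
    (hΦ : Φ =ᶠ[𝓝[>] 0] Ψ) : HasFinitePart Ψ L := by
  obtain ⟨s, c, hs, h⟩ := h
  exact ⟨s, c, hs, h.congr' (hΦ.mono fun ε hε => by simp only [hε])⟩

theorem HasFinitePart.const_mul {Φ : ℝ → ℂ} {L : ℂ} (a : ℂ) (h : HasFinitePart Φ L) :
    HasFinitePart (fun ε => a * Φ ε) (a * L) := by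
  obtain ⟨s, c, hs, h⟩ := h
  refine ⟨s, fun l => a * c l, hs, (h.const_mul a).congr fun ε => ?_⟩
  simp only [mul_sub, Finset.mul_sum, mul_assoc]

theorem HasFinitePart.add {Φ Ψ : ℝ → ℂ} {L M : ℂ} (hL : HasFinitePart Φ L)
    (hM : HasFinitePart Ψ M) : HasFinitePart (fun ε => Φ ε + Ψ ε) (L + M) := by
  classical
  obtain ⟨s, c, hs, h⟩ := hL
  obtain ⟨t, d, ht, h'⟩ := hM
  refine ⟨s ∪ t, fun l => (if l ∈ s then c l else 0) + (if l ∈ t then d l else 0), by simp [hs, ht],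
    (h.add h').congr fun ε => ?_⟩
  simp only [add_mul, Finset.sum_add_distrib, ite_mul, zero_mul, Finset.sum_ite_mem,
    Finset.union_inter_cancel_left, Finset.union_inter_cancel_right]
  ring

theorem hasFinitePart_zero : HasFinitePart (fun _ => 0) 0 :=
  ⟨∅, 0, by simp, by simp⟩

theorem HasFinitePart.sum {ι : Type*} (s : Finset ι) {Φ : ι → ℝ → ℂ} {L : ι → ℂ}
    (h : ∀ i ∈ s, HasFinitePart (Φ i) (L i)) :
    HasFinitePart (fun ε => ∑ i ∈ s, Φ i ε) (∑ i ∈ s, L i) := by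
  classical
  induction s using Finset.induction_on with
  | empty => simpa using hasFinitePart_zero
  | insert i s hi ih =>
    simp only [Finset.sum_insert hi]
    exact (h i (by simp)).add (ih fun j hj => h j (by simp [hj]))

theorem hasFinitePart_of_tendsto {Φ : ℝ → ℂ} {L : ℂ} (h : Tendsto Φ (𝓝[>] 0) (𝓝 L)) :
    HasFinitePart Φ L :=
  ⟨∅, 0, by simp, by simpa using h⟩

theorem hasFinitePart_cpow {z : ℂ} (hz : z ≠ 0) (a : ℂ) :
    HasFinitePart (fun ε : ℝ => a * (ε : ℂ) ^ z) 0 :=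
  ⟨{z}, fun _ => a, by simpa using hz.symm, by simp⟩

/-- The product of a power `ε ^ z`, `z ≠ 0, -1, -2, …`, with a smooth function has finite part
zero. -/
theorem hasFinitePart_cpow_mul {z : ℂ} (hz : ∀ k : ℕ, z ≠ -(k : ℂ)) {φ : ℝ → ℂ} {b : ℝ}
    (hb : 0 < b) (hφ : ∀ n : ℕ, ContDiffOn ℝ n φ (Set.Icc 0 b)) :
    HasFinitePart (fun ε : ℝ => (ε : ℂ) ^ z * φ ε) 0 := by
  -- With `n > -Re z`, the factor `ε^z` times the Taylor remainder of order `n` tends to zero. The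
  -- Taylor polynomial leaves powers `ε^(z+k)`, whose exponents are non-zero and which are therefore
  -- discarded.
  obtain ⟨n, hn⟩ := exists_nat_gt (-z.re)
  have h1 := taylor_isLittleO (convex_Icc 0 b) (Set.left_mem_Icc.2 hb.le) (hφ n)
  have hle : 𝓝[>] (0 : ℝ) ≤ 𝓝[Set.Icc 0 b] 0 := by
    rw [← nhdsWithin_Ioc_eq_nhdsGT hb]
    exact nhdsWithin_mono _ Set.Ioc_subset_Icc_self
  have h2 : Tendsto (fun ε : ℝ => (ε : ℂ) ^ z * (φ ε - taylorWithinEval φ n (Set.Icc 0 b) 0 ε))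
      (𝓝[>] 0) (𝓝 0) := by
    have h3 : (fun ε : ℝ => (ε : ℂ) ^ z) =O[𝓝[>] 0] fun ε : ℝ => ε ^ z.re := by
      refine Asymptotics.IsBigO.of_bound 1 ?_
      filter_upwards [self_mem_nhdsWithin] with ε hε
      rw [Complex.norm_cpow_eq_rpow_re_of_pos hε, one_mul]
      exact Real.le_norm_self _
    have h4 := h3.mul_isLittleO (h1.mono hle)
    refine (Asymptotics.isLittleO_one_iff ℝ).1 (h4.trans_isBigO ?_)
    refine Asymptotics.IsBigO.of_bound 1 ?_
    filter_upwards [self_mem_nhdsWithin, Ioc_mem_nhdsGT (zero_lt_one (α := ℝ))] with ε hε hε1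
    have hε' : 0 < ε := hε
    rw [sub_zero, ← Real.rpow_natCast, ← Real.rpow_add hε', norm_one, mul_one,
      Real.norm_of_nonneg (by positivity)]
    exact Real.rpow_le_one hε'.le hε1.2 (by linarith)
  have h5 : HasFinitePart (fun ε : ℝ => ∑ k ∈ Finset.range (n + 1),
      ((Nat.factorial k : ℂ)⁻¹ * iteratedDerivWithin k φ (Set.Icc 0 b) 0) *
        (ε : ℂ) ^ (z + k)) (∑ k ∈ Finset.range (n + 1), 0) :=
    HasFinitePart.sum _ fun k _ => hasFinitePart_cpow (fun e => hz k (eq_neg_of_add_eq_zero_left e)) _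
  have h6 := (hasFinitePart_of_tendsto h2).add h5
  rw [Finset.sum_const_zero, add_zero] at h6
  refine h6.congr ?_
  filter_upwards [self_mem_nhdsWithin] with ε hε
  have hε' : (ε : ℂ) ≠ 0 := by exact_mod_cast (ne_of_gt hε)
  rw [taylor_within_apply, mul_sub, sub_add, sub_eq_self, sub_eq_zero, Finset.mul_sum]
  refine Finset.sum_congr rfl fun k _ => ?_
  rw [Complex.cpow_add _ _ hε', Complex.cpow_natCast, Complex.real_smul]
  push_cast
  rw [sub_zero]
  ring

theorem HasFPIntegral.congr {φ ψ : ℝ → ℂ} {x : ℝ} {L : ℂ} (h : HasFPIntegral φ x L)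
    (hφ : ∀ τ ∈ Set.Ioc 0 x, φ τ = ψ τ) (hx : 0 < x) : HasFPIntegral ψ x L := by
  refine ⟨fun ε hε => (h.1 ε hε).congr fun τ hτ => ?_, h.2.congr ?_⟩
  · rw [Set.uIoc_of_le hε.2.le] at hτ
    exact hφ τ ⟨hε.1.trans hτ.1, hτ.2⟩
  · filter_upwards [Ioo_mem_nhdsGT hx] with ε hε
    refine intervalIntegral.integral_congr fun τ hτ => ?_
    rw [Set.uIcc_of_le hε.2.le] at hτ
    exact hφ τ ⟨hε.1.trans_le hτ.1, hτ.2⟩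

theorem HasFPIntegral.const_mul {φ : ℝ → ℂ} {x : ℝ} {L : ℂ} (a : ℂ) (h : HasFPIntegral φ x L) :
    HasFPIntegral (fun τ => a * φ τ) x (a * L) := by
  refine ⟨fun ε hε => (h.1 ε hε).const_mul a, ?_⟩
  simp only [intervalIntegral.integral_const_mul]
  exact h.2.const_mul a

theorem HasFPIntegral.add {φ ψ : ℝ → ℂ} {x : ℝ} {L M : ℂ} (hx : 0 < x) (h : HasFPIntegral φ x L)
    (h' : HasFPIntegral ψ x M) : HasFPIntegral (fun τ => φ τ + ψ τ) x (L + M) := by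
  refine ⟨fun ε hε => (h.1 ε hε).add (h'.1 ε hε), (h.2.add h'.2).congr ?_⟩
  filter_upwards [Ioo_mem_nhdsGT hx] with ε hε
  exact (intervalIntegral.integral_add (h.1 ε hε) (h'.1 ε hε)).symm

theorem HasFPIntegral.sum {ι : Type*} (s : Finset ι) {φ : ι → ℝ → ℂ} {L : ι → ℂ} {x : ℝ}
    (hx : 0 < x) (h : ∀ i ∈ s, HasFPIntegral (φ i) x (L i)) :
    HasFPIntegral (fun τ => ∑ i ∈ s, φ i τ) x (∑ i ∈ s, L i) := by
  classical
  induction s using Finset.induction_on with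
  | empty => exact ⟨fun _ _ => by simp, by simpa using hasFinitePart_zero⟩
  | insert i s hi ih =>
    simp only [Finset.sum_insert hi]
    exact (h i (by simp)).add hx (ih fun j hj => h j (by simp [hj]))

/-! ### The finite part of the Beta integral -/

theorem intervalIntegrable_rpow_sub {ν : ℝ} (hν : 0 < ν) (a b x : ℝ) :
    IntervalIntegrable (fun τ : ℝ => (((x - τ) ^ (ν - 1) : ℝ) : ℂ)) volume a b := by
  have h := (intervalIntegral.intervalIntegrable_rpow' (a := x - a) (b := x - b)
    (by linarith : -1 < ν - 1)).comp_sub_left x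
  simp only [sub_sub_cancel] at h
  exact ⟨h.1.ofReal, h.2.ofReal⟩

theorem cpow_sub_one_mul_self {a : ℂ} (ha : a ≠ 0) (z : ℂ) : a ^ (z - 1) * a = a ^ z := by
  rw [Complex.cpow_sub _ _ ha, Complex.cpow_one, div_mul_cancel₀ _ ha]

/-- Written in this form, the derivative links the Beta integrands with parameters `z` and `z+1`;
integrating it continues the Beta formula to the left. -/
theorem hasDerivAt_cpow_mul_rpow_sub (z : ℂ) (ν : ℝ) {x τ : ℝ} (hτ : 0 < τ) (hτx : τ < x) :
    HasDerivAt (fun τ : ℝ => (τ : ℂ) ^ z * (((x - τ) ^ ν : ℝ) : ℂ))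
      (z * x * ((((x - τ) ^ (ν - 1) : ℝ) : ℂ) * (τ : ℂ) ^ (z - 1)) -
        (z + ν) * ((((x - τ) ^ (ν - 1) : ℝ) : ℂ) * (τ : ℂ) ^ (z + 1 - 1))) τ := by
  have h1 : HasDerivAt (fun τ : ℝ => (τ : ℂ) ^ z) (z * (τ : ℂ) ^ (z - 1)) τ := by
    have := (hasDerivAt_id (τ : ℂ)).cpow_const (c := z) (Or.inl (by simpa using hτ))
    simpa using this.comp_ofReal
  have h2 : HasDerivAt (fun τ : ℝ => (((x - τ) ^ ν : ℝ) : ℂ))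
      (((-1 * ν * (x - τ) ^ (ν - 1) : ℝ)) : ℂ) τ :=
    (((hasDerivAt_id τ).const_sub x).rpow_const (Or.inl (sub_pos.2 hτx).ne')).ofReal_comp
  refine (h1.mul h2).congr_deriv ?_
  have h3 : (x - τ) ^ ν = (x - τ) * (x - τ) ^ (ν - 1) := by
    rw [mul_comm, ← Real.rpow_add_one (sub_pos.2 hτx).ne']
    congr 1; ring
  have h4 : (τ : ℂ) ^ z = τ * (τ : ℂ) ^ (z - 1) := by
    rw [mul_comm, cpow_sub_one_mul_self (by exact_mod_cast hτ.ne')]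
  rw [add_sub_cancel_right, h3, h4]
  push_cast
  ring

/-- The finite part of `∫_0^x (x-τ)^(ν-1) τ^(z-1) dτ` is `Γ(ν) Γ(z) / Γ(z+ν) x^(z+ν-1)`. -/
theorem hasFPIntegral_rpow_sub_mul_cpow {ν : ℝ} (hν : 0 < ν) {x : ℝ} (hx : 0 < x) {z : ℂ}
    (hz : ∀ k : ℕ, z ≠ -(k : ℂ)) :
    HasFPIntegral (fun τ : ℝ => (((x - τ) ^ (ν - 1) : ℝ) : ℂ) * (τ : ℂ) ^ (z - 1)) x
      (Real.Gamma ν * (Complex.Gamma z / Complex.Gamma (z + ν)) * (x : ℂ) ^ (z + ν - 1)) := by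
  have hint : ∀ (w : ℂ), ∀ ε ∈ Set.Ioo 0 x, IntervalIntegrable
      (fun τ : ℝ => (((x - τ) ^ (ν - 1) : ℝ) : ℂ) * (τ : ℂ) ^ w) volume ε x := by
    intro w ε hε
    refine (intervalIntegrable_rpow_sub hν ε x x).mul_continuousOn ?_
    rw [Set.uIcc_of_le hε.2.le]
    intro τ hτ
    exact (Complex.continuousAt_ofReal_cpow_const _ _
      (Or.inr (hε.1.trans_le hτ.1).ne')).continuousWithinAt
  -- Induction on the number of unit steps to the left of `Re z > 0`, where the integral converges
  -- and is the classical Beta integral. In each step the boundary term at `ε` has finite part zero,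
  -- and the term at `x` vanishes because `ν > 0`.
  obtain ⟨n, hn⟩ := exists_nat_gt (-z.re)
  induction n generalizing z with
  | zero =>
    have hz0 : 0 < z.re := by simpa using hn
    have hI : IntervalIntegrable
        (fun τ : ℝ => (((x - τ) ^ (ν - 1) : ℝ) : ℂ) * (τ : ℂ) ^ (z - 1)) volume 0 x := by
      have hh : 0 < x / 2 := by positivity
      refine IntervalIntegrable.trans (b := x / 2) ?_ (hint _ _ ⟨hh, by linarith⟩)
      refine (intervalIntegral.intervalIntegrable_cpow' (by simpa using hz0)).continuousOn_mul ?_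
      rw [Set.uIcc_of_le hh.le]
      intro τ hτ
      refine (Complex.continuous_ofReal.continuousAt.comp
        ((continuousAt_const.sub continuousAt_id).rpow_const (Or.inl ?_))).continuousWithinAt
      have := hτ.2
      exact (sub_pos.2 (by linarith : τ < x)).ne'
    have h := hasFPIntegral_of_intervalIntegrable hx hI
    convert h using 1
    have h1 := Complex.betaIntegral_scaled z ν hx
    rw [Complex.betaIntegral_eq_Gamma_mul_div _ _ hz0 (by simpa using hν)] at h1
    rw [← Complex.Gamma_ofReal, show ∀ a b c d : ℂ, a * (b / c) * d = d * (b * a / c) from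
      fun _ _ _ _ => by ring, ← h1]
    refine intervalIntegral.integral_congr fun τ hτ => ?_
    rw [Set.uIcc_of_le hx.le] at hτ
    rw [Complex.ofReal_cpow (sub_nonneg.2 hτ.2), mul_comm]
    push_cast
    rfl
  | succ n ih =>
    have hz0 : z ≠ 0 := by simpa using hz 0
    have hz' : ∀ k : ℕ, z + 1 ≠ -(k : ℂ) := fun k e => hz (k + 1) (by
      push_cast; linear_combination e)
    have ih := ih hz' (by simp only [Complex.add_re, Complex.one_re]; push_cast at hn; linarith)
    have hxc : (x : ℂ) ≠ 0 := by exact_mod_cast hx.ne'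
    refine ⟨hint _, ?_⟩
    have hb : HasFinitePart (fun ε : ℝ => (ε : ℂ) ^ z * (((x - ε) ^ ν : ℝ) : ℂ)) 0 := by
      refine hasFinitePart_cpow_mul (b := x / 2) hz (by positivity) fun n => ?_
      refine Complex.ofRealCLM.contDiff.comp_contDiffOn ?_
      intro τ hτ
      refine ((contDiffAt_const.sub contDiffAt_id).rpow_const_of_ne ?_).contDiffWithinAt
      have := hτ.2
      simp only [id]
      linarith
    have h := (ih.2.const_mul ((z + ν) / (z * x))).add (hb.const_mul (-1 / (z * x)))
    have hval : (z + ν) / (z * x) * (Real.Gamma ν * (Complex.Gamma (z + 1) /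
        Complex.Gamma (z + 1 + ν)) * (x : ℂ) ^ (z + 1 + ν - 1)) + -1 / (z * x) * 0 =
        Real.Gamma ν * (Complex.Gamma z / Complex.Gamma (z + ν)) * (x : ℂ) ^ (z + ν - 1) := by
      rw [Complex.Gamma_add_one _ hz0, div_eq_mul_inv (Complex.Gamma z),
        Complex.one_div_Gamma_eq_self_mul_one_div_Gamma_add_one (z + ν),
        show z + 1 + (ν : ℂ) = z + ν + 1 by ring, add_sub_cancel_right,
        show (x : ℂ) ^ (z + ν) = (x : ℂ) ^ (z + ν - 1) * x by
          rw [cpow_sub_one_mul_self hxc]]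
      field_simp
      ring
    rw [hval] at h
    refine h.congr ?_
    filter_upwards [Ioo_mem_nhdsGT hx] with ε hε
    have hcont : ContinuousOn (fun τ : ℝ => (τ : ℂ) ^ z * (((x - τ) ^ ν : ℝ) : ℂ))
        (Set.Icc ε x) := by
      intro τ hτ
      refine ((Complex.continuousAt_ofReal_cpow_const _ _
        (Or.inr (hε.1.trans_le hτ.1).ne')).mul (Complex.continuous_ofReal.continuousAt.comp
        ((continuousAt_const.sub continuousAt_id).rpow_const (Or.inr hν.le)))).continuousWithinAt
    have hF := intervalIntegral.integral_eq_sub_of_hasDerivAt_of_le hε.2.le hcont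
      (fun τ hτ => hasDerivAt_cpow_mul_rpow_sub z ν (hε.1.trans hτ.1) hτ.2)
      (((hint (z - 1) ε hε).const_mul (z * x)).sub ((hint (z + 1 - 1) ε hε).const_mul (z + ν)))
    rw [intervalIntegral.integral_sub ((hint (z - 1) ε hε).const_mul (z * x))
      ((hint (z + 1 - 1) ε hε).const_mul (z + ν)), intervalIntegral.integral_const_mul,
      intervalIntegral.integral_const_mul, sub_self, Real.zero_rpow hν.ne'] at hF
    have hzx : z * (x : ℂ) ≠ 0 := mul_ne_zero hz0 hxc
    refine mul_left_cancel₀ hzx ?_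
    rw [sub_eq_iff_eq_add.1 hF]
    field_simp
    push_cast
    ring

/-! ### Riemann–Liouville integrals of functions that vanish on the negative axis -/

/-- The Riemann–Liouville integral of order `ν > 0` with lower terminal `0`. -/
noncomputable def rlIntegral (ν : ℝ) (F : ℝ → ℂ) (x : ℝ) : ℂ :=
  ((1 / Real.Gamma ν : ℝ) : ℂ) * ∫ s in (0 : ℝ)..x, (((x - s) ^ (ν - 1) : ℝ) : ℂ) * F s

theorem intervalIntegrable_rpow_sub_mul {ν : ℝ} (hν : 0 < ν) {F : ℝ → ℂ} (hF : Continuous F)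
    (a b x : ℝ) :
    IntervalIntegrable (fun s : ℝ => (((x - s) ^ (ν - 1) : ℝ) : ℂ) * F s) volume a b :=
  (intervalIntegrable_rpow_sub hν a b x).mul_continuousOn hF.continuousOn

theorem intervalIntegrable_ofReal_rpow {ν : ℝ} (hν : 0 < ν) (a b : ℝ) :
    IntervalIntegrable (fun u : ℝ => ((u ^ (ν - 1) : ℝ) : ℂ)) volume a b :=
  have h := intervalIntegral.intervalIntegrable_rpow' (a := a) (b := b) (by linarith : -1 < ν - 1)
  ⟨h.1.ofReal, h.2.ofReal⟩

/-- The substitution `u = x - s` frees the singular weight of `x`, and the vanishing of `F` on the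
negative axis frees the upper limit. Continuity and differentiability in `x` then follow by
dominated convergence. -/
theorem rlIntegral_eq_integral_comp_sub {ν : ℝ} (hν : 0 < ν) {F : ℝ → ℂ} (hF : Continuous F)
    (h0 : ∀ x ≤ 0, F x = 0) {x X : ℝ} (hxX : x ≤ X) :
    rlIntegral ν F x =
      ((1 / Real.Gamma ν : ℝ) : ℂ) * ∫ u in (0 : ℝ)..X, ((u ^ (ν - 1) : ℝ) : ℂ) * F (x - u) := by
  have hint : ∀ a b, IntervalIntegrable (fun u : ℝ => ((u ^ (ν - 1) : ℝ) : ℂ) * F (x - u))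
      volume a b := fun a b => (intervalIntegrable_ofReal_rpow hν a b).mul_continuousOn
    (hF.comp (continuous_const.sub continuous_id)).continuousOn
  have h1 : ∫ u in x..X, ((u ^ (ν - 1) : ℝ) : ℂ) * F (x - u) = 0 := by
    refine intervalIntegral.integral_zero_ae (ae_of_all _ fun u hu => ?_)
    rw [Set.uIoc_of_le hxX] at hu
    rw [h0 _ (by linarith [hu.1]), mul_zero]
  have h2 := intervalIntegral.integral_comp_sub_left (a := 0) (b := x)
    (fun s : ℝ => (((x - s) ^ (ν - 1) : ℝ) : ℂ) * F s) x
  rw [sub_self, sub_zero] at h2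
  rw [rlIntegral, ← intervalIntegral.integral_add_adjacent_intervals (hint 0 x) (hint x X), h1,
    add_zero, ← h2]
  simp only [sub_sub_cancel]

theorem exists_bound_comp_sub {F : ℝ → ℂ} (hF : Continuous F) (x : ℝ) :
    ∃ M, ∀ u ∈ Set.uIoc 0 (|x| + 1), ∀ y ∈ Set.Icc (x - 1) (x + 1), ‖F (y - u)‖ ≤ M := by
  obtain ⟨M, hM⟩ := (isCompact_Icc (a := x - 1 - (|x| + 1)) (b := x + 1)).exists_bound_of_continuousOn
    hF.continuousOn
  refine ⟨M, fun u hu y hy => hM _ ?_⟩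
  rw [Set.uIoc_of_le (by positivity)] at hu
  exact ⟨by linarith [hu.2, hy.1], by linarith [hu.1, hy.2]⟩

theorem rlIntegral_eventuallyEq {ν : ℝ} (hν : 0 < ν) {F : ℝ → ℂ} (hF : Continuous F)
    (h0 : ∀ x ≤ 0, F x = 0) (x : ℝ) :
    rlIntegral ν F =ᶠ[𝓝 x] fun y => ((1 / Real.Gamma ν : ℝ) : ℂ) *
      ∫ u in (0 : ℝ)..(|x| + 1), ((u ^ (ν - 1) : ℝ) : ℂ) * F (y - u) := by
  filter_upwards [Iio_mem_nhds (lt_of_le_of_lt (le_abs_self x) (lt_add_one _))] with y hy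
  exact rlIntegral_eq_integral_comp_sub hν hF h0 (le_of_lt hy)

theorem continuous_rlIntegral {ν : ℝ} (hν : 0 < ν) {F : ℝ → ℂ} (hF : Continuous F)
    (h0 : ∀ x ≤ 0, F x = 0) : Continuous (rlIntegral ν F) := by
  refine continuous_iff_continuousAt.2 fun x => ?_
  refine ContinuousAt.congr ?_ (rlIntegral_eventuallyEq hν hF h0 x).symm
  obtain ⟨M, hM⟩ := exists_bound_comp_sub hF x
  have hI := intervalIntegrable_ofReal_rpow hν 0 (|x| + 1)
  refine continuousAt_const.mul (intervalIntegral.continuousAt_of_dominated_interval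
    (bound := fun u => ‖((u ^ (ν - 1) : ℝ) : ℂ)‖ * M) ?_ ?_ (hI.norm.mul_const M) ?_)
  · refine Eventually.of_forall fun y => ?_
    exact (hI.mul_continuousOn
      (hF.comp (continuous_const.sub continuous_id)).continuousOn).def'.aestronglyMeasurable
  · filter_upwards [Icc_mem_nhds (by linarith : x - 1 < x) (by linarith : x < x + 1)] with y hy
    refine ae_of_all _ fun u hu => ?_
    rw [norm_mul]
    exact mul_le_mul_of_nonneg_left (hM u hu y hy) (norm_nonneg _)
  · exact ae_of_all _ fun u _ => by fun_prop

theorem hasDerivAt_rlIntegral {ν : ℝ} (hν : 0 < ν) {F : ℝ → ℂ} (hF : ContDiff ℝ 1 F)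
    (h0 : ∀ x ≤ 0, F x = 0) (h0' : ∀ x ≤ 0, deriv F x = 0) (x : ℝ) :
    HasDerivAt (rlIntegral ν F) (rlIntegral ν (deriv F) x) x := by
  have hF' : Continuous (deriv F) := hF.continuous_deriv le_rfl
  refine HasDerivAt.congr_of_eventuallyEq ?_ (rlIntegral_eventuallyEq hν hF.continuous h0 x)
  rw [(rlIntegral_eventuallyEq hν hF' h0' x).eq_of_nhds]
  obtain ⟨M, hM⟩ := exists_bound_comp_sub hF' x
  have hI := intervalIntegrable_ofReal_rpow hν 0 (|x| + 1)
  have hint : ∀ {G : ℝ → ℂ}, Continuous G → ∀ y, IntervalIntegrable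
      (fun u : ℝ => ((u ^ (ν - 1) : ℝ) : ℂ) * G (y - u)) volume 0 (|x| + 1) := fun hG y =>
    hI.mul_continuousOn (hG.comp (continuous_const.sub continuous_id)).continuousOn
  refine HasDerivAt.const_mul _ (intervalIntegral.hasDerivAt_integral_of_dominated_loc_of_deriv_le
    (F' := fun y u => ((u ^ (ν - 1) : ℝ) : ℂ) * deriv F (y - u))
    (bound := fun u => ‖((u ^ (ν - 1) : ℝ) : ℂ)‖ * M)
    (Icc_mem_nhds (by linarith : x - 1 < x) (by linarith : x < x + 1)) ?_ (hint hF.continuous x)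
    (hint hF' x).def'.aestronglyMeasurable ?_ (hI.norm.mul_const M) ?_).2
  · exact Eventually.of_forall fun y => (hint hF.continuous y).def'.aestronglyMeasurable
  · refine ae_of_all _ fun u hu y hy => ?_
    rw [norm_mul]
    exact mul_le_mul_of_nonneg_left (hM u hu y hy) (norm_nonneg _)
  · refine ae_of_all _ fun u hu y hy => HasDerivAt.const_mul _ ?_
    exact ((hF.differentiable one_ne_zero _).hasDerivAt).comp_sub_const y u

theorem deriv_eq_zero_of_nonpos {F : ℝ → ℂ} (hF : ContDiff ℝ 1 F) (h0 : ∀ x ≤ 0, F x = 0) :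
    ∀ x ≤ 0, deriv F x = 0 := by
  have h1 : Set.EqOn (deriv F) 0 (Set.Iio 0) := fun x hx => by
    have : F =ᶠ[𝓝 x] fun _ => 0 := by
      filter_upwards [Iio_mem_nhds hx] with y hy using h0 y (le_of_lt hy)
    rw [this.deriv_eq]
    simp
  -- The derivative at `0` itself is reached by continuity from the left.
  have h2 := h1.closure (hF.continuous_deriv le_rfl) continuous_const
  rw [closure_Iio] at h2
  exact fun x hx => h2 hx

theorem iteratedDeriv_eq_zero_of_nonpos {k : ℕ} {F : ℝ → ℂ} (hF : ContDiff ℝ k F)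
    (h0 : ∀ x ≤ 0, F x = 0) : ∀ x ≤ 0, iteratedDeriv k F x = 0 := by
  induction k generalizing F with
  | zero => simpa using h0
  | succ k ih =>
    rw [iteratedDeriv_succ']
    exact ih ((contDiff_succ_iff_deriv (n := (k : ℕ))).1 (by exact_mod_cast hF)).2.2
      (deriv_eq_zero_of_nonpos (hF.of_le (by norm_cast; omega)) h0)

theorem contDiff_rlIntegral {ν : ℝ} (hν : 0 < ν) {k : ℕ} {F : ℝ → ℂ} (hF : ContDiff ℝ k F)
    (h0 : ∀ x ≤ 0, F x = 0) : ContDiff ℝ k (rlIntegral ν F) ∧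
      iteratedDeriv k (rlIntegral ν F) = rlIntegral ν (iteratedDeriv k F) := by
  induction k generalizing F with
  | zero =>
    simp only [iteratedDeriv_zero, and_true]
    exact contDiff_zero.2 (continuous_rlIntegral hν hF.continuous h0)
  | succ k ih =>
    have hF1 : ContDiff ℝ 1 F := hF.of_le (by norm_cast; omega)
    have h0' := deriv_eq_zero_of_nonpos hF1 h0
    have hd := hasDerivAt_rlIntegral hν hF1 h0 h0'
    have hde : deriv (rlIntegral ν F) = rlIntegral ν (deriv F) := funext fun x => (hd x).deriv
    obtain ⟨ih1, ih2⟩ := ih ((contDiff_succ_iff_deriv (n := (k : ℕ))).1 (by exact_mod_cast hF)).2.2 h0'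
    constructor
    · have : ContDiff ℝ ((k : ℕ) + 1) (rlIntegral ν F) := contDiff_succ_iff_deriv.2
        ⟨fun x => (hd x).differentiableAt, fun h => absurd h (by simp), by rwa [hde]⟩
      exact_mod_cast this
    · rw [iteratedDeriv_succ', iteratedDeriv_succ', hde, ih2]

/-- Integration by parts: `I^ν F = I^(ν+1) F'` if `F 0 = 0`. -/
theorem rlIntegral_eq_rlIntegral_add_one_deriv {ν : ℝ} (hν : 0 < ν) {F : ℝ → ℂ}
    (hF : ContDiff ℝ 1 F) (h0 : F 0 = 0) {x : ℝ} (hx : 0 ≤ x) :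
    rlIntegral ν F x = rlIntegral (ν + 1) (deriv F) x := by
  have hF' : Continuous (deriv F) := hF.continuous_deriv le_rfl
  have hcont : Continuous fun s : ℝ => ((-((x - s) ^ ν / ν) : ℝ) : ℂ) := by
    refine Complex.continuous_ofReal.comp (Continuous.neg (Continuous.div_const ?_ _))
    exact (continuous_const.sub continuous_id).rpow_const fun _ => Or.inr hν.le
  have h := intervalIntegral.integral_mul_deriv_eq_deriv_mul_of_hasDerivAt (a := 0) (b := x)
    (u := F) (u' := deriv F) (v := fun s : ℝ => ((-((x - s) ^ ν / ν) : ℝ) : ℂ))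
    (v' := fun s => (((x - s) ^ (ν - 1) : ℝ) : ℂ)) hF.continuous.continuousOn hcont.continuousOn
    (fun s _ => (hF.differentiable one_ne_zero _).hasDerivAt)
    (fun s hs => by
      rw [min_eq_left hx, max_eq_right hx] at hs
      have h1 := ((((hasDerivAt_id s).const_sub x).rpow_const (p := ν)
        (Or.inl (sub_pos.2 hs.2).ne')).div_const ν).neg.ofReal_comp
      refine h1.congr_deriv ?_
      congr 1
      simp only [id]
      field_simp)
    (hF'.intervalIntegrable _ _) (intervalIntegrable_rpow_sub hν 0 x x)
  rw [sub_self, Real.zero_rpow hν.ne', h0] at h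
  have hΓ : Real.Gamma ν ≠ 0 := (Real.Gamma_pos_of_pos hν).ne'
  rw [rlIntegral, rlIntegral, Real.Gamma_add_one hν.ne']
  simp only [add_sub_cancel_right]
  rw [show (∫ s in (0 : ℝ)..x, (((x - s) ^ (ν - 1) : ℝ) : ℂ) * F s) =
      ∫ s in (0 : ℝ)..x, F s * (((x - s) ^ (ν - 1) : ℝ) : ℂ) by simp only [mul_comm], h,
    show (∫ s in (0 : ℝ)..x, deriv F s * ((-((x - s) ^ ν / ν) : ℝ) : ℂ)) =
      ∫ s in (0 : ℝ)..x, (-(1 / ν : ℝ) : ℂ) * ((((x - s) ^ ν : ℝ) : ℂ) * deriv F s) by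
      congr 1; ext s; push_cast; ring, intervalIntegral.integral_const_mul]
  push_cast
  field_simp
  simp

theorem rlIntegral_eq_rlIntegral_iteratedDeriv {ν : ℝ} (hν : 0 < ν) {k : ℕ} {F : ℝ → ℂ}
    (hF : ContDiff ℝ k F) (h0 : ∀ x ≤ 0, F x = 0) {x : ℝ} (hx : 0 ≤ x) :
    rlIntegral ν F x = rlIntegral (ν + k) (iteratedDeriv k F) x := by
  induction k generalizing F ν with
  | zero => simp
  | succ k ih =>
    have hF1 : ContDiff ℝ 1 F := hF.of_le (by norm_cast; omega)
    rw [rlIntegral_eq_rlIntegral_add_one_deriv hν hF1 (h0 0 le_rfl) hx, ih (by positivity)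
      ((contDiff_succ_iff_deriv (n := (k : ℕ))).1 (by exact_mod_cast hF)).2.2
      (deriv_eq_zero_of_nonpos hF1 h0), iteratedDeriv_succ']
    push_cast
    congr 1
    ring

/-- Taylor's formula with integral remainder at a point where all derivatives vanish. -/
theorem eq_rlIntegral_iteratedDeriv {k : ℕ} (hk : 1 ≤ k) {F : ℝ → ℂ}
    (hF : ContDiff ℝ k F) (h0 : ∀ x ≤ 0, F x = 0) {x : ℝ} (hx : 0 ≤ x) :
    F x = rlIntegral k (iteratedDeriv k F) x := by
  obtain ⟨k, rfl⟩ := Nat.exists_eq_add_of_le' hk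
  have hF1 : ContDiff ℝ 1 F := hF.of_le (by norm_cast)
  have h1 : F x = rlIntegral 1 (deriv F) x := by
    have := intervalIntegral.integral_eq_sub_of_hasDerivAt (a := 0) (b := x)
      (fun s _ => (hF1.differentiable one_ne_zero s).hasDerivAt)
      ((hF1.continuous_deriv le_rfl).intervalIntegrable _ _)
    simp [rlIntegral, this, h0]
  rw [h1, rlIntegral_eq_rlIntegral_iteratedDeriv one_pos
    ((contDiff_succ_iff_deriv (n := (k : ℕ))).1 (by exact_mod_cast hF)).2.2
    (deriv_eq_zero_of_nonpos hF1 h0) hx, iteratedDeriv_succ']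
  push_cast
  congr 1
  ring

/-! ### The operator `I_s^α` on sums of powers and smooth functions -/

/-- The exponentials in `x - τ` and `τ` combine to `e^(-σx)`, which leaves the integral. What
remains is a sum of finite-part Beta integrals and one convergent Riemann–Liouville integral. -/
theorem hasFPIntegral_substKernel {ι : Type*} {s : Finset ι} {c z : ι → ℂ}
    (hz : ∀ i ∈ s, ∀ k : ℕ, z i ≠ -(k : ℂ)) {F : ℝ → ℂ} (hF : Continuous F) {σ : ℝ} {f : ℝ → ℂ}
    (hf : ∀ x : ℝ, 0 < x →
      f x = (Real.exp (-σ * x) : ℂ) * (∑ i ∈ s, c i * (x : ℂ) ^ (z i - 1) + F x))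
    {ν : ℝ} (hν : 0 < ν) {x : ℝ} (hx : 0 < x) :
    HasFPIntegral (substKernel σ ν f x) x ((Real.Gamma ν : ℂ) * ((Real.exp (-σ * x) : ℂ) *
      (∑ i ∈ s, c i * (Complex.Gamma (z i) / Complex.Gamma (z i + ν)) * (x : ℂ) ^ (z i + ν - 1) +
        rlIntegral ν F x))) := by
  have hΓ : (Real.Gamma ν : ℂ) ≠ 0 := by exact_mod_cast (Real.Gamma_pos_of_pos hν).ne'
  have h1 := HasFPIntegral.sum s hx fun i hi =>
    (hasFPIntegral_rpow_sub_mul_cpow hν hx (hz i hi)).const_mul (c i)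
  have h2 := hasFPIntegral_of_intervalIntegrable hx (intervalIntegrable_rpow_sub_mul hν hF 0 x x)
  have h3 := (h1.add hx h2).const_mul (Real.exp (-σ * x) : ℂ)
  have hval : (Real.exp (-σ * x) : ℂ) * (∑ i ∈ s, c i * (Real.Gamma ν * (Complex.Gamma (z i) /
      Complex.Gamma (z i + ν)) * (x : ℂ) ^ (z i + ν - 1)) +
      ∫ τ in (0 : ℝ)..x, (((x - τ) ^ (ν - 1) : ℝ) : ℂ) * F τ) =
      (Real.Gamma ν : ℂ) * ((Real.exp (-σ * x) : ℂ) * (∑ i ∈ s, c i * (Complex.Gamma (z i) /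
        Complex.Gamma (z i + ν)) * (x : ℂ) ^ (z i + ν - 1) + rlIntegral ν F x)) := by
    rw [mul_left_comm, mul_add (Real.Gamma ν : ℂ), Finset.mul_sum, rlIntegral]
    congr 2
    · exact Finset.sum_congr rfl fun i _ => by ring
    · push_cast
      field_simp
  rw [hval] at h3
  refine h3.congr (fun τ hτ => ?_) hx
  have he : Real.exp (-σ * x) = Real.exp (-σ * (x - τ)) * Real.exp (-σ * τ) := by
    rw [← Real.exp_add]; congr 1; ring
  rw [substKernel, hf τ hτ.1, he]
  push_cast
  rw [show ∑ i ∈ s, c i * ((((x - τ) ^ (ν - 1) : ℝ) : ℂ) * (τ : ℂ) ^ (z i - 1)) =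
    (((x - τ) ^ (ν - 1) : ℝ) : ℂ) * ∑ i ∈ s, c i * (τ : ℂ) ^ (z i - 1) by
      rw [Finset.mul_sum]; exact Finset.sum_congr rfl fun i _ => by ring]
  ring

theorem substIntegral_eq {ι : Type*} {s : Finset ι} {c z : ι → ℂ}
    (hz : ∀ i ∈ s, ∀ k : ℕ, z i ≠ -(k : ℂ)) {F : ℝ → ℂ} (hF : Continuous F) {σ : ℝ} {f : ℝ → ℂ}
    (hf : ∀ x : ℝ, 0 < x →
      f x = (Real.exp (-σ * x) : ℂ) * (∑ i ∈ s, c i * (x : ℂ) ^ (z i - 1) + F x))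
    {ν : ℝ} (hν : 0 < ν) {x : ℝ} (hx : 0 < x) :
    substIntegral σ ν f x = (Real.exp (-σ * x) : ℂ) *
      (∑ i ∈ s, c i * (Complex.Gamma (z i) / Complex.Gamma (z i + ν)) * (x : ℂ) ^ (z i + ν - 1) +
        rlIntegral ν F x) := by
  have hΓ : (Real.Gamma ν : ℂ) ≠ 0 := by exact_mod_cast (Real.Gamma_pos_of_pos hν).ne'
  rw [substIntegral, (hasFPIntegral_substKernel hz hF hf hν hx).fpIntegral_eq]
  push_cast
  rw [← mul_assoc, one_div_mul_cancel hΓ, one_mul]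

theorem contDiffOn_ofReal_cpow (w : ℂ) (n : ℕ) :
    ContDiffOn ℝ n (fun x : ℝ => (x : ℂ) ^ w) (Set.Ioi 0) := by
  have h : ContDiffOn ℝ n (fun x : ℝ => Complex.exp ((Real.log x : ℂ) * w)) (Set.Ioi 0) := by
    refine (Complex.contDiff_exp (𝕜 := ℝ)).comp_contDiffOn (ContDiffOn.mul ?_ contDiffOn_const)
    exact Complex.ofRealCLM.contDiff.comp_contDiffOn
      (Real.contDiffOn_log.mono fun x hx => (ne_of_gt hx))
  refine h.congr fun x hx => ?_
  rw [Complex.cpow_def_of_ne_zero (by exact_mod_cast (ne_of_gt hx)),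
    ← Complex.ofReal_log (le_of_lt hx)]

theorem contDiff_exp_mul (σ : ℝ) (n : ℕ) :
    ContDiff ℝ n (fun x : ℝ => (Real.exp (σ * x) : ℂ)) :=
  Complex.ofRealCLM.contDiff.comp (Real.contDiff_exp.comp (contDiff_const.mul contDiff_id))

theorem hasDerivAt_ofReal_cpow_of_pos {x : ℝ} (hx : 0 < x) (w : ℂ) :
    HasDerivAt (fun x : ℝ => (x : ℂ) ^ w) (w * (x : ℂ) ^ (w - 1)) x := by
  have := (hasDerivAt_id (x : ℂ)).cpow_const (c := w) (Or.inl (by simpa using hx))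
  simpa using this.comp_ofReal

/-- `D_s^m` lowers the exponents of the powers by `m`. -/
theorem iterate_substD_eq {ι : Type*} {s : Finset ι} {c z : ι → ℂ} {σ : ℝ} {a : ℂ} (m : ℕ)
    {H : ℝ → ℂ} (hH : ContDiff ℝ m H) {v : ℝ → ℂ}
    (hv : ∀ x : ℝ, 0 < x → v x = (Real.exp (-σ * x) : ℂ) *
      (∑ i ∈ s, c i * (Complex.Gamma (z i) / Complex.Gamma (z i + a + m)) *
        (x : ℂ) ^ (z i + a + m - 1) + H x)) {x : ℝ} (hx : 0 < x) :
    (substD σ)^[m] v x = (Real.exp (-σ * x) : ℂ) *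
      (∑ i ∈ s, c i * (Complex.Gamma (z i) / Complex.Gamma (z i + a)) *
        (x : ℂ) ^ (z i + a - 1) + iteratedDeriv m H x) := by
  induction m generalizing v H with
  | zero => simpa using hv x hx
  | succ m ih =>
    have hH' := (contDiff_succ_iff_deriv (n := (m : ℕ))).1 (by exact_mod_cast hH)
    rw [Function.iterate_succ_apply, iteratedDeriv_succ']
    refine ih hH'.2.2 fun y hy => ?_
    have hsum : HasDerivAt (fun x : ℝ => ∑ i ∈ s, c i * (Complex.Gamma (z i) /
        Complex.Gamma (z i + a + (m + 1 : ℕ))) * (x : ℂ) ^ (z i + a + (m + 1 : ℕ) - 1))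
        (∑ i ∈ s, c i * (Complex.Gamma (z i) / Complex.Gamma (z i + a + m)) *
          (y : ℂ) ^ (z i + a + m - 1)) y := by
      refine HasDerivAt.fun_sum fun i _ => ?_
      refine ((hasDerivAt_ofReal_cpow_of_pos hy _).const_mul _).congr_deriv ?_
      -- The recursion is used for `1/Γ`, where it also holds at the poles, so the shifted exponents
      -- need not avoid them.
      rw [div_eq_mul_inv _ (Complex.Gamma (z i + a + m)),
        Complex.one_div_Gamma_eq_self_mul_one_div_Gamma_add_one (z i + a + m)]
      push_cast
      rw [← add_assoc, add_sub_cancel_right]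
      ring
    have hexp : HasDerivAt (fun x : ℝ => (Real.exp (-σ * x) : ℂ))
        ((Real.exp (-σ * y) * (-σ * 1) : ℝ) : ℂ) y :=
      (((hasDerivAt_id y).const_mul (-σ)).exp).ofReal_comp
    have hd := hexp.mul (hsum.add (hH'.1 y).hasDerivAt)
    have hev : v =ᶠ[𝓝 y] fun x : ℝ => (Real.exp (-σ * x) : ℂ) *
        (∑ i ∈ s, c i * (Complex.Gamma (z i) / Complex.Gamma (z i + a + (m + 1 : ℕ))) *
        (x : ℂ) ^ (z i + a + (m + 1 : ℕ) - 1) + H x) := by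
      filter_upwards [Ioi_mem_nhds hy] with x hx using hv x hx
    rw [substD, (hd.congr_of_eventuallyEq hev).deriv, hv y hy]
    push_cast
    simp only [Pi.add_apply]
    ring

/-- One formula serves all signs of `α`: integrating by parts `k` times moves the derivatives onto
`F` and leaves an integral of positive order `α + k`. For `α = 0` it is Taylor's formula. -/
theorem substOp_eq {ι : Type*} {s : Finset ι} {c z : ι → ℂ}
    (hz : ∀ i ∈ s, ∀ k : ℕ, z i ≠ -(k : ℂ)) {α : ℝ} {k : ℕ} (hk : 1 ≤ k)
    (hkα : derivOrder (-α) ≤ k) {F : ℝ → ℂ} (hF : ContDiff ℝ k F) (h0 : ∀ x ≤ 0, F x = 0)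
    {σ : ℝ} {f : ℝ → ℂ}
    (hf : ∀ x : ℝ, 0 < x →
      f x = (Real.exp (-σ * x) : ℂ) * (∑ i ∈ s, c i * (x : ℂ) ^ (z i - 1) + F x)) :
    SubstOpExists σ α f ∧ ∀ x : ℝ, 0 < x → substOp σ α f x = (Real.exp (-σ * x) : ℂ) *
      (∑ i ∈ s, c i * (Complex.Gamma (z i) / Complex.Gamma (z i + α)) * (x : ℂ) ^ (z i + α - 1) +
        rlIntegral (α + k) (iteratedDeriv k F) x) := by
  have hν : α < 0 → 0 < (derivOrder (-α) : ℝ) - -α := fun hα => by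
    rw [derivOrder, Nat.cast_add_one]
    linarith [Nat.lt_floor_add_one (-α)]
  refine ⟨⟨fun hα x hx => ⟨_, hasFPIntegral_substKernel hz hF.continuous hf hα hx⟩, fun hα =>
    ⟨fun x hx => ⟨_, hasFPIntegral_substKernel hz hF.continuous hf (hν hα) hx⟩, ?_⟩⟩, ?_⟩
  · refine ContDiffOn.congr (ContDiffOn.mul (contDiff_exp_mul (-σ) _).contDiffOn (ContDiffOn.add
      (ContDiffOn.sum fun i _ => contDiffOn_const.mul (contDiffOn_ofReal_cpow _ _))
      (contDiff_rlIntegral (hν hα) (hF.of_le (by exact_mod_cast hkα)) h0).1.contDiffOn))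
      fun x hx => substIntegral_eq hz hF.continuous hf (hν hα) hx
  · intro x hx
    rcases lt_trichotomy α 0 with hα | rfl | hα
    · rw [substOp, if_neg hα.not_gt, if_neg hα.ne, substDeriv]
      set m := derivOrder (-α) with hm
      have hFm : ContDiff ℝ m F := hF.of_le (by exact_mod_cast hkα)
      obtain ⟨h1, h2⟩ := contDiff_rlIntegral (hν hα) hFm h0
      rw [iterate_substD_eq (s := s) (c := c) (z := z) (a := α) m h1 (fun y hy => ?_) hx, h2]
      · obtain ⟨l, rfl⟩ := Nat.exists_eq_add_of_le' hkα
        have h3 : ContDiff ℝ l (iteratedDeriv m F) := by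
          rw [iteratedDeriv_eq_iterate]
          exact hF.iterate_deriv' l m
        -- `D_s^m` has put `m` derivatives on `F`; the other `l = k - m` come from integration by
        -- parts, raising the order from `α + m` to `α + k`.
        rw [rlIntegral_eq_rlIntegral_iteratedDeriv (hν hα) h3
          (iteratedDeriv_eq_zero_of_nonpos hFm h0) hx.le]
        simp only [iteratedDeriv_eq_iterate, ← Function.iterate_add_apply]
        congr 3
        push_cast
        ring
      · rw [substIntegral_eq hz hF.continuous hf (hν hα) hy]
        congr 2
        refine Finset.sum_congr rfl fun i _ => ?_
        push_cast
        rw [show z i + ((m : ℂ) - -(α : ℂ)) = z i + α + m by ring]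
    · rw [substOp, if_neg (lt_irrefl _), if_pos rfl, hf x hx, zero_add,
        ← eq_rlIntegral_iteratedDeriv hk hF h0 hx.le]
      congr 2
      refine Finset.sum_congr rfl fun i hi => ?_
      rw [Complex.ofReal_zero, add_zero, div_self (Complex.Gamma_ne_zero (hz i hi)), mul_one]
    · rw [substOp, if_pos hα, substIntegral_eq hz hF.continuous hf hα hx,
        rlIntegral_eq_rlIntegral_iteratedDeriv hα hF h0 hx.le]

/-! ### Taylor remainders and their products with powers -/

/-- `R` is `N` times continuously differentiable on `[0, ∞)`, and its derivatives of order less than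
`N` vanish at `0`. -/
def VanishesToOrder : ℕ → (ℝ → ℂ) → Prop
  | 0, R => ContinuousOn R (Set.Ici 0)
  | N + 1, R => R 0 = 0 ∧ ∃ R' : ℝ → ℂ,
      (∀ x ∈ Set.Ici (0 : ℝ), HasDerivWithinAt R (R' x) (Set.Ici 0) x) ∧ VanishesToOrder N R'

theorem VanishesToOrder.continuousOn {N : ℕ} {R : ℝ → ℂ} (h : VanishesToOrder N R) :
    ContinuousOn R (Set.Ici 0) := by
  cases N with
  | zero => exact h
  | succ N =>
    obtain ⟨_, R', hR', _⟩ := h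
    exact fun x hx => (hR' x hx).continuousWithinAt

theorem VanishesToOrder.const_mul {N : ℕ} {R : ℝ → ℂ} (h : VanishesToOrder N R) (a : ℂ) :
    VanishesToOrder N fun x => a * R x := by
  induction N generalizing R with
  | zero => exact continuousOn_const.mul h
  | succ N ih =>
    obtain ⟨h0, R', hR', hV⟩ := h
    exact ⟨by simp [h0], _, fun x hx => (hR' x hx).const_mul a, ih hV⟩

theorem exists_vanishesToOrder_sub {N : ℕ} {g : ℝ → ℂ} (hg : ContDiffOn ℝ N g (Set.Ici 0)) :
    ∃ c : ℕ → ℂ, VanishesToOrder N fun x => g x - ∑ q ∈ Finset.range N, c q * (x : ℂ) ^ q := by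
  induction N generalizing g with
  | zero => exact ⟨0, by simpa [VanishesToOrder] using hg.continuousOn⟩
  | succ N ih =>
    have h1 := (contDiffOn_succ_iff_derivWithin (n := (N : ℕ)) (uniqueDiffOn_Ici 0)).1
      (by exact_mod_cast hg)
    obtain ⟨c, hc⟩ := ih h1.2.2
    -- The Taylor polynomial of `g` is the antiderivative, with value `g 0` at the origin, of the
    -- one for `g'`.
    refine ⟨fun q => Nat.casesOn q (g 0) fun q => c q / (q + 1), ?_, _, fun x hx => ?_, hc⟩
    · simp [Finset.sum_range_succ']
    · refine (h1.1 x hx).hasDerivWithinAt.sub ?_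
      simp only [Finset.sum_range_succ', pow_zero, mul_one]
      refine HasDerivWithinAt.congr_deriv (HasDerivWithinAt.add (HasDerivWithinAt.fun_sum fun q _ =>
        HasDerivAt.hasDerivWithinAt
          ((((hasDerivAt_id (x : ℂ)).pow (q + 1)).comp_ofReal).const_mul _))
        (hasDerivWithinAt_const _ _ _)) ?_
      rw [add_zero]
      refine Finset.sum_congr rfl fun q _ => ?_
      have : (q : ℂ) + 1 ≠ 0 := by exact_mod_cast q.succ_ne_zero
      simp
      field_simp

/-- Each application of the mean value inequality on `[0, x]` gains a factor `x`. -/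
theorem VanishesToOrder.exists_bound {N : ℕ} {R : ℝ → ℂ} (h : VanishesToOrder N R) (b : ℝ) :
    ∃ C, 0 ≤ C ∧ ∀ x ∈ Set.Icc 0 b, ‖R x‖ ≤ C * x ^ N := by
  induction N generalizing R with
  | zero =>
    obtain ⟨C, hC⟩ := (isCompact_Icc (a := 0) (b := b)).exists_bound_of_continuousOn
      (ContinuousOn.mono h fun x hx => hx.1)
    exact ⟨max C 0, le_max_right _ _, fun x hx => by simpa using Or.inl (hC x hx)⟩
  | succ N ih =>
    obtain ⟨h0, R', hR', hV⟩ := h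
    obtain ⟨C, hC0, hC⟩ := ih hV
    refine ⟨C, hC0, fun x hx => ?_⟩
    have h1 := Convex.norm_image_sub_le_of_norm_hasDerivWithin_le (f := R) (f' := R')
      (s := Set.Icc 0 x) (C := C * x ^ N) (x := 0) (y := x)
      (fun y hy => (hR' y hy.1).mono fun t ht => ht.1)
      (fun y hy => (hC y ⟨hy.1, hy.2.trans hx.2⟩).trans
        (mul_le_mul_of_nonneg_left (pow_le_pow_left₀ hy.1 hy.2 _) hC0))
      (convex_Icc 0 x) (Set.left_mem_Icc.2 hx.1) (Set.right_mem_Icc.2 hx.1)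
    rw [h0, sub_zero, sub_zero, Real.norm_of_nonneg hx.1] at h1
    rw [pow_succ, ← mul_assoc]
    exact h1

/-- The function `x ^ γ * R x` for `x > 0`, extended by zero. -/
noncomputable def cpowMulPos (γ : ℂ) (R : ℝ → ℂ) (x : ℝ) : ℂ :=
  if x ≤ 0 then 0 else (x : ℂ) ^ γ * R x

theorem cpowMulPos_of_nonpos {γ : ℂ} {R : ℝ → ℂ} {x : ℝ} (hx : x ≤ 0) : cpowMulPos γ R x = 0 :=
  if_pos hx

theorem cpowMulPos_of_pos {γ : ℂ} {R : ℝ → ℂ} {x : ℝ} (hx : 0 < x) :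
    cpowMulPos γ R x = (x : ℂ) ^ γ * R x :=
  if_neg hx.not_ge

theorem exists_norm_cpowMulPos_le {N : ℕ} {R : ℝ → ℂ} (h : VanishesToOrder N R) (γ : ℂ) (b : ℝ) :
    ∃ C, 0 ≤ C ∧ ∀ x ≤ b, ‖cpowMulPos γ R x‖ ≤ C * |x| ^ (γ.re + N) := by
  obtain ⟨C, hC0, hC⟩ := h.exists_bound b
  refine ⟨C, hC0, fun x hx => ?_⟩
  rcases le_or_gt x 0 with h0 | h0
  · rw [cpowMulPos_of_nonpos h0, norm_zero]
    positivity
  · rw [cpowMulPos_of_pos h0, norm_mul, Complex.norm_cpow_eq_rpow_re_of_pos h0, abs_of_pos h0,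
      Real.rpow_add h0, Real.rpow_natCast, mul_left_comm]
    exact mul_le_mul_of_nonneg_left (hC x ⟨h0.le, hx⟩) (by positivity)

theorem continuous_cpowMulPos {N : ℕ} {R : ℝ → ℂ} (h : VanishesToOrder N R) {γ : ℂ}
    (hγ : 0 < γ.re + N) : Continuous (cpowMulPos γ R) := by
  refine continuous_iff_continuousAt.2 fun x => ?_
  rcases lt_trichotomy x 0 with hx | rfl | hx
  · refine continuousAt_const.congr (f := fun _ => 0) ?_
    filter_upwards [Iio_mem_nhds hx] with y hy using (cpowMulPos_of_nonpos (le_of_lt hy)).symm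
  · obtain ⟨C, hC0, hC⟩ := exists_norm_cpowMulPos_le h γ 1
    rw [ContinuousAt, cpowMulPos_of_nonpos le_rfl]
    refine squeeze_zero_norm' (a := fun x : ℝ => C * |x| ^ (γ.re + N)) ?_ ?_
    · filter_upwards [Iic_mem_nhds (zero_lt_one (α := ℝ))] with y hy using hC y hy
    · have : ContinuousAt (fun x : ℝ => C * |x| ^ (γ.re + N)) 0 :=
        continuousAt_const.mul (continuous_abs.continuousAt.rpow_const (Or.inr hγ.le))
      have h2 := this.tendsto
      simpa [Real.zero_rpow hγ.ne'] using h2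
  · have h1 : ContinuousAt R x := h.continuousOn.continuousAt (Ici_mem_nhds hx)
    refine ((Complex.continuousAt_ofReal_cpow_const x γ (Or.inr hx.ne')).mul h1).congr ?_
    filter_upwards [Ioi_mem_nhds hx] with y hy using (cpowMulPos_of_pos hy).symm

theorem hasDerivAt_cpowMulPos {N : ℕ} {R R' : ℝ → ℂ} (h : VanishesToOrder N R)
    (hR' : ∀ x ∈ Set.Ici (0 : ℝ), HasDerivWithinAt R (R' x) (Set.Ici 0) x) {γ : ℂ}
    (hγ : 1 < γ.re + N) (x : ℝ) :
    HasDerivAt (cpowMulPos γ R)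
      (cpowMulPos (γ - 1) (fun y => γ * R y) x + cpowMulPos γ R' x) x := by
  rcases lt_trichotomy x 0 with hx | rfl | hx
  · rw [cpowMulPos_of_nonpos hx.le, cpowMulPos_of_nonpos hx.le, add_zero]
    refine (hasDerivAt_const x (0 : ℂ)).congr_of_eventuallyEq ?_
    filter_upwards [Iio_mem_nhds hx] with y hy using cpowMulPos_of_nonpos (le_of_lt hy)
  · rw [cpowMulPos_of_nonpos le_rfl, cpowMulPos_of_nonpos le_rfl, add_zero,
      hasDerivAt_iff_isLittleO_nhds_zero]
    obtain ⟨C, hC0, hC⟩ := exists_norm_cpowMulPos_le h γ 1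
    simp only [zero_add, cpowMulPos_of_nonpos le_rfl, sub_zero, smul_zero]
    have h1 : cpowMulPos γ R =O[𝓝 0] fun x : ℝ => |x| ^ (γ.re + N - 1) * x := by
      refine Asymptotics.IsBigO.of_bound C ?_
      filter_upwards [Iic_mem_nhds (zero_lt_one (α := ℝ))] with y hy
      refine (hC y hy).trans_eq ?_
      rw [norm_mul, Real.norm_of_nonneg (by positivity), Real.norm_eq_abs,
        ← Real.rpow_add_one' (abs_nonneg y) (by linarith), sub_add_cancel]
    have h2 : (fun x : ℝ => |x| ^ (γ.re + N - 1)) =o[𝓝 0] fun _ => (1 : ℝ) := by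
      rw [Asymptotics.isLittleO_one_iff]
      have h3 : ContinuousAt (fun x : ℝ => |x| ^ (γ.re + N - 1)) 0 :=
        continuous_abs.continuousAt.rpow_const (Or.inr (by linarith))
      have h4 := h3.tendsto
      rwa [abs_zero, Real.zero_rpow (by linarith)] at h4
    have h3 := h2.mul_isBigO (Asymptotics.isBigO_refl (fun x : ℝ => x) (𝓝 0))
    simp only [one_mul] at h3
    exact h1.trans_isLittleO h3
  · have h1 : HasDerivAt R (R' x) x := (hR' x hx.le).hasDerivAt (Ici_mem_nhds hx)
    have h2 := (hasDerivAt_ofReal_cpow_of_pos hx γ).mul h1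
    rw [cpowMulPos_of_pos hx, cpowMulPos_of_pos hx]
    refine (h2.congr_of_eventuallyEq ?_).congr_deriv (by ring)
    filter_upwards [Ioi_mem_nhds hx] with y hy using cpowMulPos_of_pos hy

/-- The product rule yields two functions of the same kind, one with `γ` lowered by one, the other
with `N` lowered by one. Both lose one unit of `γ.re + N`, in step with `k`. -/
theorem contDiff_cpowMulPos {k N : ℕ} (hkN : k ≤ N) {R : ℝ → ℂ} (h : VanishesToOrder N R) {γ : ℂ}
    (hγ : k < γ.re + N) : ContDiff ℝ k (cpowMulPos γ R) := by
  induction k generalizing N R γ with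
  | zero => exact contDiff_zero.2 (continuous_cpowMulPos h (by simpa using hγ))
  | succ k ih =>
    obtain ⟨N, rfl⟩ := Nat.exists_eq_add_of_le' (Nat.one_le_of_lt hkN)
    obtain ⟨-, R', hR', hV⟩ := id h
    push_cast at hγ
    have hd := hasDerivAt_cpowMulPos h hR' (γ := γ) (by
      push_cast
      have : (0 : ℝ) ≤ k := k.cast_nonneg
      linarith)
    have hde := funext fun x => (hd x).deriv
    have : ContDiff ℝ ((k : ℕ) + 1) (cpowMulPos γ R) := by
      refine contDiff_succ_iff_deriv.2
        ⟨fun x => (hd x).differentiableAt, fun h => absurd h (by simp), ?_⟩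
      rw [hde]
      refine (ih (by omega) (h.const_mul γ) ?_).add (ih (by omega) hV ?_)
      · rw [Complex.sub_re, Complex.one_re]; push_cast; linarith
      · linarith
    exact_mod_cast this

/-! ### Quadrature errors for powers -/

/-- The error of the unscaled quadrature `∑ ω_{n-j} j^(z-1)` for a power. -/
noncomputable def powerError (α : ℝ) (ω : ℕ → ℂ) (z : ℂ) (n : ℕ) : ℂ :=
  ∑ j ∈ Finset.range (n + 1), ω (n - j) * (j : ℂ) ^ (z - 1) -
    Complex.Gamma z / Complex.Gamma (z + α) * (n : ℂ) ^ (z + α - 1)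

theorem convWeight_mul_exp (σ : ℝ) (ω : ℕ → ℂ) (h : ℝ) {n j : ℕ} (hj : j ≤ n) :
    convWeight σ ω h (n - j) * (Real.exp (-σ * (j * h)) : ℂ) =
      (Real.exp (-σ * (n * h)) : ℂ) * ω (n - j) := by
  have : Real.exp (-σ * (n * h)) = Real.exp (-(((n - j : ℕ) : ℝ) * σ * h)) *
      Real.exp (-σ * (j * h)) := by
    rw [← Real.exp_add, Nat.cast_sub hj]
    congr 1
    ring
  rw [convWeight, this]
  push_cast
  ring

theorem convQuad_eq {σ α : ℝ} {ω : ℕ → ℂ} {h : ℝ} {n : ℕ} {f u : ℝ → ℂ}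
    (hf : ∀ j : ℕ, f (j * h) = (Real.exp (-σ * (j * h)) : ℂ) * u (j * h)) :
    convQuad σ α ω h n f = (Real.exp (-σ * (n * h)) : ℂ) *
      (((h ^ α : ℝ) : ℂ) * ∑ j ∈ Finset.range (n + 1), ω (n - j) * u (j * h)) := by
  rw [convQuad, mul_left_comm, Finset.mul_sum (Finset.range (n + 1)) _ (Real.exp _ : ℂ)]
  congr 1
  refine Finset.sum_congr rfl fun j hj => ?_
  rw [hf, ← mul_assoc, convWeight_mul_exp σ ω h (Nat.lt_succ_iff.1 (Finset.mem_range.1 hj)),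
    mul_assoc]

theorem ofReal_rpow_mul_cpow {h : ℝ} (hh : 0 < h) (α : ℝ) (z : ℂ) (n : ℕ) :
    ((h ^ α : ℝ) : ℂ) * (((n * h : ℝ) : ℂ)) ^ (z - 1) =
      (h : ℂ) ^ (z + α - 1) * (n : ℂ) ^ (z - 1) := by
  have hc : (h : ℂ) ≠ 0 := by exact_mod_cast hh.ne'
  rw [Complex.ofReal_mul, Complex.mul_cpow_ofReal_nonneg n.cast_nonneg hh.le,
    Complex.ofReal_cpow hh.le, show z + (α : ℂ) - 1 = α + (z - 1) by ring, Complex.cpow_add _ _ hc,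
    Complex.ofReal_natCast]
  ring

/-- The scaled form of `powerError`. -/
theorem rpow_mul_sum_sub_eq_powerError {h : ℝ} (hh : 0 < h) (α : ℝ) (ω : ℕ → ℂ) (z : ℂ) (n : ℕ) :
    ((h ^ α : ℝ) : ℂ) * ∑ j ∈ Finset.range (n + 1), ω (n - j) * ((j * h : ℝ) : ℂ) ^ (z - 1) -
      Complex.Gamma z / Complex.Gamma (z + α) * ((n * h : ℝ) : ℂ) ^ (z + α - 1) =
    (h : ℂ) ^ (z + α - 1) * powerError α ω z n := by
  rw [powerError, mul_sub, Finset.mul_sum, Finset.mul_sum, Complex.ofReal_mul,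
    Complex.mul_cpow_ofReal_nonneg n.cast_nonneg hh.le, Complex.ofReal_natCast]
  congr 1
  · refine Finset.sum_congr rfl fun j _ => ?_
    rw [mul_left_comm, ofReal_rpow_mul_cpow hh]
    ring
  · ring

/-- At `h = 1/n` the scaled error is `e^(-σ) n^(-(z+α-1))` times the unscaled one. The unscaled
error does not involve `h`, so a hypothesis about `x = 1` alone controls all step sizes. -/
theorem exists_norm_powerError_le {σ α : ℝ} {ω : ℕ → ℂ} {p : ℕ}
    (hω : IsConvergentOfOrder σ α ω p) {z : ℂ} (hz : ∀ k : ℕ, z ≠ -(k : ℂ)) :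
    ∃ C, 0 ≤ C ∧ ∀ n : ℕ, 1 ≤ n →
      ‖powerError α ω z n‖ ≤ C * ((n : ℝ) ^ (α - 1) + (n : ℝ) ^ (α + z.re - 1 - p)) := by
  -- The comparison function is positive for `n ≥ 1`, so the asymptotic bound holds for every such
  -- `n` after enlarging the constant.
  obtain ⟨C, hC0, hC⟩ := Asymptotics.bound_of_isBigO_nat_atTop (hω z hz)
  refine ⟨Real.exp σ * C, by positivity, fun n hn => ?_⟩
  have hn0 : (0 : ℝ) < n := by exact_mod_cast hn
  have hh : (0 : ℝ) < 1 / n := by positivity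
  have hnh : (n : ℝ) * (1 / n) = 1 := by field_simp
  have hop := (substOp_eq (s := {()}) (c := fun _ => 1) (z := fun _ => z) (fun _ _ => hz)
    (α := α) (k := derivOrder (-α)) (by simp [derivOrder]) le_rfl (F := fun _ => 0)
    contDiff_const (fun _ _ => rfl) (σ := σ)
    (f := fun t => (Real.exp (-σ * t) : ℂ) * (t : ℂ) ^ (z - 1)) (fun x _ => by simp)).2
    (n * (1 / n)) (by rw [hnh]; exact one_pos)
  have hrl : rlIntegral (α + derivOrder (-α)) (iteratedDeriv (derivOrder (-α)) fun _ => 0)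
      (n * (1 / n)) = 0 := by
    simp [rlIntegral]
  rw [hrl, Finset.sum_singleton, one_mul, add_zero] at hop
  have hE : quadError σ α ω (1 / (n : ℝ)) n
      (fun t => (Real.exp (-σ * t) : ℂ) * (t : ℂ) ^ (z - 1)) =
      (Real.exp (-σ) : ℂ) * (((1 / n : ℝ) : ℂ) ^ (z + α - 1) * powerError α ω z n) := by
    rw [← rpow_mul_sum_sub_eq_powerError hh, quadError, hop,
      convQuad_eq (u := fun t => (t : ℂ) ^ (z - 1)) (fun _ => rfl), ← mul_sub, hnh, mul_one]
  have h1 := hC (x := n) (by positivity)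
  rw [hE, norm_mul, norm_mul, Complex.norm_real, Real.norm_of_nonneg (Real.exp_pos _).le,
    Complex.norm_cpow_eq_rpow_re_of_pos hh, Real.norm_of_nonneg (by positivity),
    ← Real.rpow_natCast] at h1
  have h2 : ∀ e : ℝ, (1 / (n : ℝ)) ^ e = (n : ℝ) ^ (-e) := fun e => by
    rw [one_div, Real.inv_rpow hn0.le, Real.rpow_neg hn0.le]
  simp only [h2] at h1
  have hre : (z + (α : ℂ) - 1).re = z.re + α - 1 := by simp
  rw [hre] at h1
  have h3 : ‖powerError α ω z n‖ = Real.exp σ * (n : ℝ) ^ (z.re + α - 1) *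
      (Real.exp (-σ) * ((n : ℝ) ^ (-(z.re + α - 1)) * ‖powerError α ω z n‖)) := by
    rw [Real.exp_neg, Real.rpow_neg hn0.le]
    field_simp
  rw [h3]
  refine (mul_le_mul_of_nonneg_left h1 (by positivity)).trans_eq ?_
  rw [show α - 1 = (z.re + α - 1) + -z.re by ring,
    show α + z.re - 1 - p = (z.re + α - 1) + -(p : ℝ) by ring, Real.rpow_add hn0,
    Real.rpow_add hn0]
  ring

/-! ### Quadrature errors for shifted powers -/

/-- Valid at the poles too, which matters when `α` is a non-positive integer. -/
theorem inv_realGamma_eq (s : ℝ) : (Real.Gamma s)⁻¹ = s * (Real.Gamma (s + 1))⁻¹ := by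
  rcases eq_or_ne s 0 with rfl | h
  · simp
  · rw [Real.Gamma_add_one h, mul_inv, mul_inv_cancel_left₀ h]

/-- The error of the unscaled quadrature for the function `x^K/K!` at the point `n + θ`. -/
noncomputable def shiftedError (α : ℝ) (ω : ℕ → ℂ) (K n : ℕ) (θ : ℝ) : ℂ :=
  ∑ j ∈ Finset.range (n + 1), ω (n - j) * (((j + θ) ^ K / K.factorial : ℝ) : ℂ) -
    (((n + θ) ^ (α + K) * (Real.Gamma (α + K + 1))⁻¹ : ℝ) : ℂ)

theorem shiftedError_zero (α : ℝ) (ω : ℕ → ℂ) (K n : ℕ) :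
    shiftedError α ω K n 0 = (K.factorial : ℂ)⁻¹ * powerError α ω (K + 1) n := by
  have hK : (K.factorial : ℂ) ≠ 0 := by exact_mod_cast K.factorial_ne_zero
  rw [shiftedError, powerError, mul_sub, Finset.mul_sum, Complex.Gamma_nat_eq_factorial]
  simp only [add_zero, add_sub_cancel_right, Complex.cpow_natCast]
  congr 1
  · refine Finset.sum_congr rfl fun j _ => ?_
    push_cast
    ring
  · have h1 : Complex.Gamma (K + 1 + α) = ((Real.Gamma (α + K + 1) : ℝ) : ℂ) := by
      rw [← Complex.Gamma_ofReal]
      push_cast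
      congr 1
      ring
    rw [h1, show (K : ℂ) + 1 + α - 1 = ((α + K : ℝ) : ℂ) by push_cast; ring,
      Complex.ofReal_mul, Complex.ofReal_cpow n.cast_nonneg, Complex.ofReal_natCast,
      Complex.ofReal_inv]
    field_simp

theorem hasDerivAt_rpow_mul_inv_gamma (α : ℝ) (K : ℕ) {n : ℕ} (hn : 1 ≤ n) {θ : ℝ} (hθ : 0 ≤ θ) :
    HasDerivAt (fun θ : ℝ => (((n + θ) ^ (α + K) * (Real.Gamma (α + K + 1))⁻¹ : ℝ) : ℂ))
      (((n + θ) ^ (α + K - 1) * (Real.Gamma (α + K))⁻¹ : ℝ) : ℂ) θ := by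
  have hn0 : (0 : ℝ) < n := by exact_mod_cast hn
  have h := ((((hasDerivAt_id θ).const_add (n : ℝ)).rpow_const (p := α + K)
    (Or.inl (by simp only [id]; positivity))).mul_const ((Real.Gamma (α + K + 1))⁻¹)).ofReal_comp
  refine h.congr_deriv ?_
  rw [inv_realGamma_eq (α + K)]
  simp only [id]
  push_cast
  ring

theorem hasDerivAt_shiftedError_succ (α : ℝ) (ω : ℕ → ℂ) (K : ℕ) {n : ℕ} (hn : 1 ≤ n) {θ : ℝ}
    (hθ : 0 ≤ θ) : HasDerivAt (shiftedError α ω (K + 1) n) (shiftedError α ω K n θ) θ := by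
  have h2 := hasDerivAt_rpow_mul_inv_gamma α (K + 1) hn hθ
  have h1 : HasDerivAt (fun θ : ℝ => ∑ j ∈ Finset.range (n + 1),
      ω (n - j) * (((j + θ) ^ (K + 1) / (K + 1).factorial : ℝ) : ℂ))
      (∑ j ∈ Finset.range (n + 1), ω (n - j) * (((j + θ) ^ K / K.factorial : ℝ) : ℂ)) θ := by
    refine HasDerivAt.fun_sum fun j _ => ?_
    have h := (((((hasDerivAt_id θ).const_add (j : ℝ)).pow (K + 1)).div_const
      ((K + 1).factorial : ℝ)).ofReal_comp).const_mul (ω (n - j))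
    refine h.congr_deriv ?_
    congr 2
    rw [Nat.factorial_succ]
    have : (K.factorial : ℝ) ≠ 0 := by exact_mod_cast K.factorial_ne_zero
    simp only [id, Nat.cast_mul, Nat.cast_succ, Nat.add_sub_cancel]
    field_simp
  refine (h1.sub h2).congr_deriv ?_
  rw [shiftedError]
  push_cast
  rw [show α + (K + 1) - 1 = α + (K : ℝ) by ring, ← add_assoc]

theorem add_rpow_le {n : ℕ} (hn : 1 ≤ n) {θ : ℝ} (hθ : θ ∈ Set.Icc (0 : ℝ) 1) (a : ℝ) :
    ((n : ℝ) + θ) ^ a ≤ 2 ^ |a| * (n : ℝ) ^ a := by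
  have hn1 : (1 : ℝ) ≤ n := by exact_mod_cast hn
  have hn0 : (0 : ℝ) < n := by linarith
  have h1 : (n : ℝ) + θ = (1 + θ / n) * n := by field_simp
  have h2 : 0 ≤ θ / n := div_nonneg hθ.1 hn0.le
  have h3 : θ / n ≤ 1 := (div_le_one hn0).2 (hθ.2.trans hn1)
  rw [h1, Real.mul_rpow (by linarith) hn0.le]
  refine mul_le_mul_of_nonneg_right ?_ (by positivity)
  calc (1 + θ / n) ^ a ≤ (1 + θ / n) ^ |a| :=
        Real.rpow_le_rpow_of_exponent_le (by linarith) (le_abs_self a)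
    _ ≤ 2 ^ |a| := Real.rpow_le_rpow (by linarith) (by linarith) (abs_nonneg a)

/-- At `θ = 0` the error is a power error with exponent `z = K + 1`, bounded by hypothesis. The mean
value inequality in `θ` carries the bound over `[0, 1]`, since the `θ`-derivative is the error of
degree `K - 1`. For `K = 0` the sum is constant in `θ`, and only the derivative of the exact value,
of size `n^(α-1)`, remains. -/
theorem exists_norm_shiftedError_le {σ α : ℝ} {ω : ℕ → ℂ} {p : ℕ}
    (hω : IsConvergentOfOrder σ α ω p) (K : ℕ) :
    ∃ C, 0 ≤ C ∧ ∀ n : ℕ, 1 ≤ n → ∀ θ ∈ Set.Icc (0 : ℝ) 1,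
      ‖shiftedError α ω K n θ‖ ≤ C * ((n : ℝ) ^ (α - 1) + (n : ℝ) ^ (α + K - p)) := by
  have hz : ∀ K : ℕ, ∀ k : ℕ, (K : ℂ) + 1 ≠ -(k : ℂ) := fun K k e => by
    have : ((K + 1 + k : ℕ) : ℂ) = 0 := by push_cast; linear_combination e
    rw [Nat.cast_eq_zero] at this
    omega
  have hre : ∀ K : ℕ, α + ((K : ℂ) + 1).re - 1 - p = α + K - p := fun K => by
    simp only [Complex.add_re, Complex.natCast_re, Complex.one_re]; ring
  have hzero : ∀ K : ℕ, ∃ C, 0 ≤ C ∧ ∀ n : ℕ, 1 ≤ n →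
      ‖shiftedError α ω K n 0‖ ≤ C * ((n : ℝ) ^ (α - 1) + (n : ℝ) ^ (α + K - p)) := fun K => by
    obtain ⟨C, hC0, hC⟩ := exists_norm_powerError_le hω (hz K)
    refine ⟨‖(K.factorial : ℂ)⁻¹‖ * C, by positivity, fun n hn => ?_⟩
    have := hC n hn
    rw [hre] at this
    rw [shiftedError_zero, norm_mul, mul_assoc]
    exact mul_le_mul_of_nonneg_left this (norm_nonneg _)
  induction K with
  | zero =>
    obtain ⟨C, hC0, hC⟩ := hzero 0
    refine ⟨C + 2 ^ |α - 1| * |(Real.Gamma α)⁻¹|, by positivity, fun n hn θ hθ => ?_⟩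
    have hn0 : (0 : ℝ) < n := by exact_mod_cast hn
    have h1 : ∀ t ∈ Set.Icc (0 : ℝ) 1, HasDerivWithinAt (shiftedError α ω 0 n)
        (0 - (((n + t) ^ (α + (0 : ℕ) - 1) * (Real.Gamma (α + (0 : ℕ)))⁻¹ : ℝ) : ℂ))
        (Set.Icc 0 1) t := fun t ht => by
      refine (HasDerivAt.sub ?_ (hasDerivAt_rpow_mul_inv_gamma α 0 hn ht.1)).hasDerivWithinAt
      simp only [pow_zero]
      exact hasDerivAt_const _ _
    have h2 := Convex.norm_image_sub_le_of_norm_hasDerivWithin_le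
      (C := 2 ^ |α - 1| * |(Real.Gamma α)⁻¹| * (n : ℝ) ^ (α - 1)) h1 (fun t ht => by
        rw [zero_sub, norm_neg, Complex.norm_real, norm_mul, Nat.cast_zero, add_zero,
          Real.norm_eq_abs (Real.Gamma α)⁻¹, Real.norm_of_nonneg
            (Real.rpow_nonneg (add_nonneg hn0.le ht.1) _), mul_right_comm]
        exact mul_le_mul_of_nonneg_right (add_rpow_le hn ht _) (abs_nonneg _))
      (convex_Icc 0 1) (Set.left_mem_Icc.2 zero_le_one) hθ
    rw [sub_zero, Real.norm_of_nonneg hθ.1] at h2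
    have h3 := norm_le_norm_add_norm_sub' (shiftedError α ω 0 n θ) (shiftedError α ω 0 n 0)
    have h4 : 2 ^ |α - 1| * |(Real.Gamma α)⁻¹| * (n : ℝ) ^ (α - 1) * θ ≤
        2 ^ |α - 1| * |(Real.Gamma α)⁻¹| * ((n : ℝ) ^ (α - 1) + (n : ℝ) ^ (α + (0 : ℕ) - p)) := by
      rw [mul_assoc _ _ θ]
      refine mul_le_mul_of_nonneg_left ?_ (by positivity)
      refine (mul_le_of_le_one_right (by positivity) hθ.2).trans ?_
      exact le_add_of_nonneg_right (by positivity)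
    rw [add_mul]
    exact h3.trans (add_le_add (hC n hn) (h2.trans h4))
  | succ K ih =>
    obtain ⟨C, hC0, hC⟩ := hzero (K + 1)
    obtain ⟨C', hC0', hC'⟩ := ih
    refine ⟨C + C', by positivity, fun n hn θ hθ => ?_⟩
    have hn1 : (1 : ℝ) ≤ n := by exact_mod_cast hn
    have h2 := Convex.norm_image_sub_le_of_norm_hasDerivWithin_le (f := shiftedError α ω (K + 1) n)
      (f' := shiftedError α ω K n) (s := Set.Icc 0 1)
      (fun t ht => (hasDerivAt_shiftedError_succ α ω K hn ht.1).hasDerivWithinAt)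
      (fun t ht => hC' n hn t ht) (convex_Icc 0 1) (Set.left_mem_Icc.2 zero_le_one) hθ
    rw [sub_zero, Real.norm_of_nonneg hθ.1] at h2
    have h3 := norm_le_norm_add_norm_sub' (shiftedError α ω (K + 1) n θ)
      (shiftedError α ω (K + 1) n 0)
    have h4 : C' * ((n : ℝ) ^ (α - 1) + (n : ℝ) ^ (α + K - p)) * θ ≤
        C' * ((n : ℝ) ^ (α - 1) + (n : ℝ) ^ (α + (K + 1 : ℕ) - p)) := by
      refine (mul_le_of_le_one_right (by positivity) hθ.2).trans ?_
      gcongr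
      omega
    rw [add_mul]
    exact h3.trans (add_le_add (hC n hn) (h2.trans h4))

/-! ### The Peano kernel -/

/-- The error of the unscaled quadrature for the truncated power `x_+^K/K!` at the point `t`. -/
noncomputable def peanoKernel (α : ℝ) (ω : ℕ → ℂ) (K n : ℕ) (t : ℝ) : ℂ :=
  ∑ i ∈ Finset.range (n + 1), ω i * ((max (t - i) 0 ^ K / K.factorial : ℝ) : ℂ) -
    ((t ^ (α + K) * (Real.Gamma (α + K + 1))⁻¹ : ℝ) : ℂ)

theorem peanoKernel_eq_shiftedError (α : ℝ) (ω : ℕ → ℂ) {K : ℕ} (hK : K ≠ 0) {m n : ℕ} (hmn : m ≤ n)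
    {θ : ℝ} (hθ0 : 0 ≤ θ) (hθ1 : θ < 1) :
    peanoKernel α ω K n (m + θ) = shiftedError α ω K m θ := by
  rw [peanoKernel, shiftedError]
  congr 1
  rw [← Finset.sum_subset (Finset.range_mono (Nat.succ_le_succ hmn)),
    ← Finset.sum_flip (n := m)]
  · refine Finset.sum_congr rfl fun j hj => ?_
    have hjm : j ≤ m := Nat.lt_succ_iff.1 (Finset.mem_range.1 hj)
    have : (m : ℝ) + θ - (m - j : ℕ) = j + θ := by
      rw [Nat.cast_sub hjm]
      ring
    rw [this, max_eq_left (by positivity)]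
  · intro i _ hi
    have h1 : (m : ℝ) + 1 ≤ i := by
      rw [Finset.mem_range, not_lt] at hi
      exact_mod_cast hi
    -- `K ≠ 0` is essential: `0 ^ 0 = 1` would keep the terms beyond `m`.
    rw [max_eq_right (by linarith), zero_pow hK]
    simp

theorem exists_norm_peanoKernel_le {σ α : ℝ} {ω : ℕ → ℂ} {p : ℕ}
    (hω : IsConvergentOfOrder σ α ω p) {K : ℕ} (hK : K ≠ 0) (hpK : p ≤ K + 1)
    (hpα : (p : ℝ) ≤ α + K) :
    ∃ C, 0 ≤ C ∧ ∀ n : ℕ, ∀ t ∈ Set.Icc (0 : ℝ) n,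
      ‖peanoKernel α ω K n t‖ ≤ C * (1 + t) ^ (α + K - p) := by
  obtain ⟨C, hC0, hC⟩ := exists_norm_shiftedError_le hω K
  refine ⟨2 * C + (‖ω 0‖ + |(Real.Gamma (α + K + 1))⁻¹|), by positivity, fun n t ht => ?_⟩
  have hp0 : (0 : ℝ) ≤ p := p.cast_nonneg
  have hpK' : (p : ℝ) ≤ K + 1 := by exact_mod_cast hpK
  set m := ⌊t⌋₊ with hm
  set θ := t - m with hθ
  have hθ0 : 0 ≤ θ := sub_nonneg.2 (Nat.floor_le ht.1)
  have hθ1 : θ < 1 := by linarith [Nat.lt_floor_add_one t]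
  have hmn : m ≤ n := by
    have := Nat.floor_le_floor ht.2
    rwa [Nat.floor_natCast] at this
  have ht' : t = m + θ := by rw [hθ]; ring
  rw [ht', peanoKernel_eq_shiftedError α ω hK hmn hθ0 hθ1, ← ht', add_mul]
  -- The shifted bound needs `m ≥ 1`. For `t < 1` only `ω 0` enters, and a constant suffices because
  -- the exponent `α + K - p` is non-negative.
  rcases Nat.eq_zero_or_pos m with hm0 | hm1
  · refine le_trans ?_ (le_add_of_nonneg_left (by have := ht.1; positivity))
    refine le_trans ?_ (le_mul_of_one_le_right (by positivity)
      (Real.one_le_rpow (by linarith [ht.1]) (by linarith)))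
    rw [shiftedError, hm0]
    refine (norm_sub_le _ _).trans (add_le_add ?_ ?_)
    · simp only [zero_add, Finset.sum_range_one, Nat.cast_zero, Nat.sub_zero]
      rw [norm_mul, Complex.norm_real, Real.norm_of_nonneg (by positivity)]
      refine mul_le_of_le_one_right (norm_nonneg _) ?_
      refine div_le_one_of_le₀ ((pow_le_one₀ hθ0 hθ1.le).trans ?_) (by positivity)
      exact_mod_cast K.factorial_pos
    · rw [Nat.cast_zero, zero_add, Complex.norm_real, norm_mul, Real.norm_eq_abs (Real.Gamma _)⁻¹,
        Real.norm_of_nonneg (by positivity)]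
      exact mul_le_of_le_one_left (abs_nonneg _) (Real.rpow_le_one hθ0 hθ1.le (by linarith))
  · refine le_trans ?_ (le_add_of_nonneg_right (by have := ht.1; positivity))
    refine (hC m hm1 θ ⟨hθ0, hθ1.le⟩).trans ?_
    have hm1' : (1 : ℝ) ≤ m := by exact_mod_cast hm1
    have h1 : (m : ℝ) ^ (α - 1) ≤ (m : ℝ) ^ (α + K - p) :=
      Real.rpow_le_rpow_of_exponent_le hm1' (by linarith)
    have h2 : (m : ℝ) ^ (α + K - p) ≤ (1 + t) ^ (α + K - p) :=
      Real.rpow_le_rpow (by linarith) (by linarith) (by linarith)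
    rw [mul_comm 2 C, mul_assoc]
    exact mul_le_mul_of_nonneg_left (by linarith) hC0

/-- Truncating the Taylor kernel gives all nodes `y ≤ x` the same interval of integration, so the
quadrature sum can be taken under the integral. -/
theorem eq_integral_max_mul_iteratedDeriv {K : ℕ} (hK : K ≠ 0) {F : ℝ → ℂ}
    (hF : ContDiff ℝ (K + 1 : ℕ) F) (h0 : ∀ x ≤ 0, F x = 0) {y x : ℝ} (hy : 0 ≤ y) (hyx : y ≤ x) :
    F y = ∫ s in (0 : ℝ)..x, ((max (y - s) 0 ^ K / K.factorial : ℝ) : ℂ) *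
      iteratedDeriv (K + 1) F s := by
  have hG : Continuous (iteratedDeriv (K + 1) F) := hF.continuous_iteratedDeriv' (K + 1)
  have hc : Continuous fun s : ℝ => ((max (y - s) 0 ^ K / K.factorial : ℝ) : ℂ) *
      iteratedDeriv (K + 1) F s := by fun_prop
  rw [← intervalIntegral.integral_add_adjacent_intervals (hc.intervalIntegrable 0 y)
    (hc.intervalIntegrable y x)]
  have h1 : ∫ s in y..x, ((max (y - s) 0 ^ K / K.factorial : ℝ) : ℂ) *
      iteratedDeriv (K + 1) F s = 0 := by
    refine intervalIntegral.integral_zero_ae (ae_of_all _ fun s hs => ?_)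
    rw [Set.uIoc_of_le hyx] at hs
    rw [max_eq_right (by linarith [hs.1]), zero_pow hK]
    simp
  rw [h1, add_zero, eq_rlIntegral_iteratedDeriv (by omega) hF h0 hy, rlIntegral,
    ← intervalIntegral.integral_const_mul]
  refine intervalIntegral.integral_congr fun s hs => ?_
  rw [Set.uIcc_of_le hy] at hs
  rw [max_eq_left (by linarith [hs.2]), Nat.cast_add_one, Real.Gamma_nat_eq_factorial,
    add_sub_cancel_right, Real.rpow_natCast]
  push_cast
  ring

theorem rpow_mul_sum_sub_rlIntegral_eq {α : ℝ} {ω : ℕ → ℂ} {K : ℕ} (hK : K ≠ 0) (hα : 0 ≤ α + K)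
    {F : ℝ → ℂ} (hF : ContDiff ℝ (K + 1 : ℕ) F) (h0 : ∀ x ≤ 0, F x = 0) {h : ℝ} (hh : 0 < h)
    (n : ℕ) :
    ((h ^ α : ℝ) : ℂ) * ∑ j ∈ Finset.range (n + 1), ω (n - j) * F (j * h) -
      rlIntegral (α + (K + 1 : ℕ)) (iteratedDeriv (K + 1) F) (n * h) =
    ∫ s in (0 : ℝ)..n * h, ((h ^ (α + K) : ℝ) : ℂ) * peanoKernel α ω K n (n - s / h) *
      iteratedDeriv (K + 1) F s := by
  have hG : Continuous (iteratedDeriv (K + 1) F) := hF.continuous_iteratedDeriv' (K + 1)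
  have hnh : 0 ≤ n * h := by positivity
  have h1 : ∀ j ∈ Finset.range (n + 1), ω (n - j) * F (j * h) =
      ∫ s in (0 : ℝ)..n * h, ω (n - j) * (((max (j * h - s) 0 ^ K / K.factorial : ℝ) : ℂ) *
        iteratedDeriv (K + 1) F s) := fun j hj => by
    have hjn : (j : ℝ) ≤ n := by exact_mod_cast Nat.lt_succ_iff.1 (Finset.mem_range.1 hj)
    rw [intervalIntegral.integral_const_mul, ← eq_integral_max_mul_iteratedDeriv hK hF h0
      (by positivity) (mul_le_mul_of_nonneg_right hjn hh.le)]
  have hi1 : ∀ j ∈ Finset.range (n + 1), IntervalIntegrable (fun s : ℝ => ω (n - j) *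
      (((max (j * h - s) 0 ^ K / K.factorial : ℝ) : ℂ) * iteratedDeriv (K + 1) F s)) volume 0
      (n * h) := fun j _ => Continuous.intervalIntegrable (by fun_prop) _ _
  have hi2 := intervalIntegrable_rpow_sub_mul (ν := α + (K + 1 : ℕ)) (by push_cast; linarith) hG 0
    (n * h) (n * h)
  rw [Finset.sum_congr rfl h1, ← intervalIntegral.integral_finsetSum hi1, rlIntegral,
    ← intervalIntegral.integral_const_mul, ← intervalIntegral.integral_const_mul,
    ← intervalIntegral.integral_sub
      ((Continuous.intervalIntegrable (by fun_prop) _ _).const_mul _)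
      (hi2.const_mul _)]
  refine intervalIntegral.integral_congr fun s hs => ?_
  rw [Set.uIcc_of_le hnh] at hs
  have hsn : 0 ≤ n - s / h := by
    rw [sub_nonneg, div_le_iff₀ hh]
    exact hs.2
  have hs2 : (n : ℝ) * h - s = h * (n - s / h) := by field_simp
  have hterm : ∀ j ∈ Finset.range (n + 1), ω (n - j) * (((max (j * h - s) 0 ^ K / K.factorial : ℝ) : ℂ)
      * iteratedDeriv (K + 1) F s) = ((h ^ K : ℝ) : ℂ) * iteratedDeriv (K + 1) F s *
      (ω (n - j) * ((max ((n - s / h) - (n - j : ℕ)) 0 ^ K / K.factorial : ℝ) : ℂ)) :=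
    fun j hj => by
      rw [Nat.cast_sub (Nat.lt_succ_iff.1 (Finset.mem_range.1 hj)),
        show (n : ℝ) - s / h - (n - j) = j - s / h by ring,
        show (j : ℝ) * h - s = h * (j - s / h) by field_simp,
        show max (h * ((j : ℝ) - s / h)) 0 = h * max ((j : ℝ) - s / h) 0 by
          rw [mul_max_of_nonneg _ _ hh.le, mul_zero], mul_pow]
      push_cast
      ring
  rw [Finset.sum_congr rfl hterm, ← Finset.mul_sum, Finset.sum_flip (n := n)
    (fun i => ω i * ((max ((n - s / h) - (i : ℕ)) 0 ^ K / K.factorial : ℝ) : ℂ)), peanoKernel, hs2,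
    Real.mul_rpow hh.le hsn, Real.rpow_add hh, Real.rpow_natCast,
    show α + ((K + 1 : ℕ) : ℝ) - 1 = α + K by push_cast; ring,
    show α + ((K + 1 : ℕ) : ℝ) = α + K + 1 by push_cast; ring, Real.rpow_add hh, Real.rpow_natCast]
  push_cast
  ring

/-- The quadrature has error `O(h^p)` for smooth functions that vanish on the negative axis. -/
theorem exists_norm_rpow_mul_sum_sub_rlIntegral_le {σ α : ℝ} {ω : ℕ → ℂ} {p : ℕ}
    (hω : IsConvergentOfOrder σ α ω p) {K : ℕ} (hK : K ≠ 0) (hpK : p ≤ K + 1)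
    (hpα : (p : ℝ) ≤ α + K) {F : ℝ → ℂ} (hF : ContDiff ℝ (K + 1 : ℕ) F) (h0 : ∀ x ≤ 0, F x = 0)
    (X : ℝ) :
    ∃ C, 0 ≤ C ∧ ∀ h : ℝ, 0 < h → ∀ n : ℕ, 1 ≤ n → n * h ≤ X →
      ‖((h ^ α : ℝ) : ℂ) * ∑ j ∈ Finset.range (n + 1), ω (n - j) * F (j * h) -
        rlIntegral (α + (K + 1 : ℕ)) (iteratedDeriv (K + 1) F) (n * h)‖ ≤ C * h ^ p := by
  obtain ⟨C, hC0, hC⟩ := exists_norm_peanoKernel_le hω hK hpK hpα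
  have hG : Continuous (iteratedDeriv (K + 1) F) := hF.continuous_iteratedDeriv' (K + 1)
  obtain ⟨M, hM⟩ := (isCompact_Icc (a := 0) (b := X)).exists_bound_of_continuousOn hG.continuousOn
  have hp0 : (0 : ℝ) ≤ p := p.cast_nonneg
  refine ⟨C * (2 * |X|) ^ (α + K - p) * |M| * |X|, by positivity, fun h hh n hn hX => ?_⟩
  have hn1 : (1 : ℝ) ≤ n := by exact_mod_cast hn
  have hnh : 0 ≤ n * h := by positivity
  have hhX : h ≤ X := (le_mul_of_one_le_left hh.le hn1).trans hX
  have hX0 : 0 < X := hh.trans_le hhX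
  rw [rpow_mul_sum_sub_rlIntegral_eq hK (hp0.trans hpα) hF h0 hh]
  refine (intervalIntegral.norm_integral_le_of_norm_le_const
    (C := C * (2 * |X|) ^ (α + K - p) * |M| * h ^ p) fun s hs => ?_).trans ?_
  · rw [Set.uIoc_of_le hnh] at hs
    have hsh : 0 ≤ s / h := div_nonneg hs.1.le hh.le
    have ht : n - s / h ∈ Set.Icc (0 : ℝ) n :=
      ⟨by rw [sub_nonneg, div_le_iff₀ hh]; exact hs.2, by linarith⟩
    -- Split off `h^p`; the remaining powers combine to `(h(1+t))^(α+K-p)` with `t ≤ n`, and `h(1+n)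
    -- ≤ 2X` because `h ≤ nh ≤ X`.
    have h1 : h ^ (α + K) * (C * (1 + (n - s / h)) ^ (α + K - p)) ≤
        C * (2 * |X|) ^ (α + K - p) * h ^ p := by
      have h2 : h ^ (α + K) = h ^ (α + K - p) * h ^ p := by
        rw [← Real.rpow_natCast, ← Real.rpow_add hh, sub_add_cancel]
      rw [h2, show ∀ a b c d : ℝ, a * b * (c * d) = c * (a * d) * b from fun _ _ _ _ => by ring,
        ← Real.mul_rpow hh.le (by linarith [ht.1])]
      refine mul_le_mul_of_nonneg_right (mul_le_mul_of_nonneg_left ?_ hC0) (by positivity)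
      refine Real.rpow_le_rpow (mul_nonneg hh.le (by linarith [ht.1])) ?_ (by linarith)
      rw [abs_of_pos hX0]
      nlinarith [ht.2]
    rw [norm_mul, norm_mul, Complex.norm_real, Real.norm_of_nonneg (by positivity), mul_right_comm _ |M|]
    refine mul_le_mul ((mul_le_mul_of_nonneg_left (hC n _ ht) (by positivity)).trans h1)
      ((hM s ⟨hs.1.le, hs.2.trans hX⟩).trans (le_abs_self M)) (norm_nonneg _) (by positivity)
  · rw [sub_zero, abs_of_nonneg hnh, mul_right_comm _ |X|]
    exact mul_le_mul_of_nonneg_left (hX.trans (le_abs_self X)) (by positivity)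

/-! ### Starting weights -/

theorem sum_Icc_one_eq_sum_fin (r : ℕ) (a : ℕ → ℂ) :
    ∑ j ∈ Finset.Icc 1 r, a j = ∑ j : Fin r, a (j + 1) := by
  rw [← Finset.sum_range (fun j => a (j + 1)), show Finset.Icc 1 r = Finset.Ico 1 (r + 1) from rfl,
    Finset.sum_Ico_eq_sum_range, Nat.add_sub_cancel]
  simp only [add_comm 1]

/-- The matrix `(j^(q+β-1))`, `0 ≤ q < r`, `1 ≤ j ≤ r`, has a right inverse. -/
theorem exists_inverse_power_matrix (β : ℂ) (r : ℕ) :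
    ∃ B : ℕ → ℕ → ℂ, ∀ d : ℕ → ℂ, ∀ q < r,
      ∑ j ∈ Finset.Icc 1 r, (∑ i ∈ Finset.range r, B j i * d i) * (j : ℂ) ^ ((q : ℂ) + β - 1) =
        d q := by
  set A : Matrix (Fin r) (Fin r) ℂ := (Matrix.vandermonde fun j : Fin r => ((j + 1 : ℕ) : ℂ)).transpose *
    Matrix.diagonal fun j : Fin r => ((j + 1 : ℕ) : ℂ) ^ (β - 1) with hA
  have hne : ∀ j : ℕ, ((j + 1 : ℕ) : ℂ) ≠ 0 := fun j => by exact_mod_cast j.succ_ne_zero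
  have hdet : IsUnit A.det := by
    rw [hA, Matrix.det_mul, Matrix.det_transpose, Matrix.det_diagonal, isUnit_iff_ne_zero]
    refine mul_ne_zero (Matrix.det_vandermonde_ne_zero_iff.2 fun i j hij => ?_)
      (Finset.prod_ne_zero_iff.2 fun j _ => ?_)
    · simp only [Nat.cast_inj] at hij
      exact Fin.ext (by omega)
    · rw [Complex.cpow_ne_zero_iff]
      exact Or.inl (hne j)
  have hAq : ∀ q j : Fin r, A q j = ((j + 1 : ℕ) : ℂ) ^ ((q : ℂ) + β - 1) := fun q j => by
    rw [hA, Matrix.mul_diagonal, Matrix.transpose_apply, Matrix.vandermonde_apply, add_sub_assoc,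
      Complex.cpow_add _ _ (hne j), Complex.cpow_natCast]
  refine ⟨fun j i => if h : j - 1 < r ∧ i < r then A⁻¹ ⟨j - 1, h.1⟩ ⟨i, h.2⟩ else 0,
    fun d q hq => ?_⟩
  have h1 : A.mulVec (A⁻¹.mulVec fun i : Fin r => d i) ⟨q, hq⟩ = d q := by
    rw [Matrix.mulVec_mulVec, Matrix.mul_nonsing_inv _ hdet, Matrix.one_mulVec]
  rw [← h1, sum_Icc_one_eq_sum_fin, Matrix.mulVec, dotProduct]
  refine Finset.sum_congr rfl fun j _ => ?_
  rw [hAq, mul_comm, Matrix.mulVec, dotProduct, Finset.sum_range]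
  congr 1
  refine Finset.sum_congr rfl fun i _ => ?_
  simp

/-- The contribution of the starting weights is `O(h^p)` for functions that vanish to sufficiently
high order. -/
theorem exists_norm_rpow_mul_sum_weights_le {α : ℝ} {r p : ℕ} {v : ℕ → ℕ → ℂ} {E e C₁ C₂ X : ℝ}
    (hE : 0 ≤ E) (hsum : α + e - E = p + 1) (hC₁ : 0 ≤ C₁) (hC₂ : 0 ≤ C₂) (he : 0 ≤ e)
    (hv : ∀ n : ℕ, 1 ≤ n → ∀ j ∈ Finset.Icc 1 r, ‖v n j‖ ≤ C₁ * (n : ℝ) ^ E) {F : ℝ → ℂ}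
    (hF : ∀ x ≤ r * X, ‖F x‖ ≤ C₂ * |x| ^ e) :
    ∃ C, 0 ≤ C ∧ ∀ h : ℝ, 0 < h → ∀ n : ℕ, 1 ≤ n → n * h ≤ X →
      ‖((h ^ α : ℝ) : ℂ) * ∑ j ∈ Finset.Icc 1 r, v n j * F (j * h)‖ ≤ C * h ^ p := by
  refine ⟨r * (C₁ * C₂ * (r : ℝ) ^ e * |X| ^ E * |X|), by positivity, fun h hh n hn hX => ?_⟩
  have hn1 : (1 : ℝ) ≤ n := by exact_mod_cast hn
  have hhX : h ≤ X := (le_mul_of_one_le_left hh.le hn1).trans hX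
  have hX0 : 0 < X := hh.trans_le hhX
  have hnE : (n : ℝ) ^ E ≤ X ^ E * h ^ (-E) := by
    rw [Real.rpow_neg hh.le, ← div_eq_mul_inv, ← Real.div_rpow hX0.le hh.le]
    exact Real.rpow_le_rpow (by linarith) ((le_div_iff₀ hh).2 hX) hE
  have hterm : ∀ j ∈ Finset.Icc 1 r,
      ‖v n j * F (j * h)‖ ≤ C₁ * (X ^ E * h ^ (-E)) * (C₂ * ((r : ℝ) ^ e * h ^ e)) := fun j hj => by
    have hjr : (j : ℝ) ≤ r := by exact_mod_cast (Finset.mem_Icc.1 hj).2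
    rw [norm_mul]
    refine mul_le_mul ((hv n hn j hj).trans (mul_le_mul_of_nonneg_left hnE hC₁)) ?_ (norm_nonneg _)
      (by positivity)
    refine (hF _ (mul_le_mul hjr hhX hh.le (by positivity))).trans
      (mul_le_mul_of_nonneg_left ?_ hC₂)
    rw [abs_of_nonneg (by positivity), Real.mul_rpow (by positivity) hh.le]
    exact mul_le_mul_of_nonneg_right (Real.rpow_le_rpow (by positivity) hjr he) (by positivity)
  have hs := (norm_sum_le _ _).trans (Finset.sum_le_card_nsmul _ _ _ hterm)
  rw [Nat.card_Icc, Nat.add_sub_cancel, nsmul_eq_mul] at hs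
  -- One power of `h` is to spare; it is absorbed by `h ≤ X`.
  have hpow : h ^ α * (h ^ (-E) * h ^ e) = h ^ p * h := by
    rw [← Real.rpow_add hh, ← Real.rpow_add hh, show α + (-E + e) = ((p + 1 : ℕ) : ℝ) by
      push_cast; linarith, Real.rpow_natCast, pow_succ]
  rw [norm_mul, Complex.norm_real, Real.norm_of_nonneg (by positivity)]
  refine (mul_le_mul_of_nonneg_left hs (by positivity)).trans ?_
  rw [show h ^ α * (r * (C₁ * (X ^ E * h ^ (-E)) * (C₂ * ((r : ℝ) ^ e * h ^ e)))) =
    r * (C₁ * C₂ * (r : ℝ) ^ e * X ^ E) * (h ^ α * (h ^ (-E) * h ^ e)) by ring, hpow,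
    abs_of_pos hX0, show r * (C₁ * C₂ * (r : ℝ) ^ e * X ^ E * X) * h ^ p =
    r * (C₁ * C₂ * (r : ℝ) ^ e * X ^ E) * (h ^ p * X) by ring]
  gcongr

/-- The expansion of `x^(β-1) g(x)` in powers, with a remainder that vanishes to high order. -/
theorem exists_cpow_mul_eq_sum_add {β : ℂ} (hβ : ∀ k : ℕ, β ≠ -(k : ℂ)) (σ : ℝ) {r : ℕ} (hr : r ≠ 0)
    {g : ℝ → ℂ} (hg : ContDiffOn ℝ r g (Set.Ici 0)) :
    ∃ (c : ℕ → ℂ) (R : ℝ → ℂ), VanishesToOrder r R ∧ ∀ x : ℝ, 0 ≤ x →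
      (x : ℂ) ^ (β - 1) * g x = (Real.exp (-σ * x) : ℂ) *
        (∑ q ∈ Finset.range r, c q * (x : ℂ) ^ ((q : ℂ) + β - 1) + cpowMulPos (β - 1) R x) := by
  -- The function expanded is `e^(σx) g`, so that the powers come out multiplied by `e^(-σx)`.
  obtain ⟨c, hc⟩ := exists_vanishesToOrder_sub ((contDiff_exp_mul σ r).contDiffOn.mul hg)
  refine ⟨c, _, hc, fun x hx => ?_⟩
  -- The node `j = 0` enters the quadrature, so the expansion must respect the conventions for `0 ^
  -- z`. Only for `β = 1` is there a contribution, from `q = 0`; otherwise no exponent is zero and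
  -- both sides vanish.
  rcases hx.eq_or_lt with rfl | hx
  · rw [cpowMulPos_of_nonpos le_rfl, add_zero]
    obtain ⟨r, rfl⟩ := Nat.exists_eq_succ_of_ne_zero hr
    have h0 := sub_eq_zero.1 hc.1
    simp only [mul_zero, Real.exp_zero, Complex.ofReal_one, one_mul] at h0 ⊢
    rcases eq_or_ne β 1 with rfl | hβ1
    · simpa using h0
    · rw [Complex.ofReal_zero, Complex.zero_cpow (sub_ne_zero.2 hβ1), zero_mul, eq_comm]
      refine Finset.sum_eq_zero fun q _ => ?_
      rw [Complex.zero_cpow, mul_zero]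
      rcases q with _ | q
      · simpa [sub_eq_zero] using hβ1
      · intro e
        push_cast at e
        exact hβ q (by linear_combination e)
  · have hxc : (x : ℂ) ≠ 0 := by exact_mod_cast hx.ne'
    have he : (Real.exp (-σ * x) : ℂ) * (Real.exp (σ * x) : ℂ) = 1 := by
      rw [← Complex.ofReal_mul, ← Real.exp_add]
      simp
    have hs : ∑ q ∈ Finset.range r, c q * (x : ℂ) ^ ((q : ℂ) + β - 1) =
        (x : ℂ) ^ (β - 1) * ∑ q ∈ Finset.range r, c q * (x : ℂ) ^ q := by
      rw [Finset.mul_sum]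
      refine Finset.sum_congr rfl fun q _ => ?_
      rw [add_sub_assoc, Complex.cpow_add _ _ hxc, Complex.cpow_natCast]
      ring
    rw [cpowMulPos_of_pos hx, hs]
    linear_combination -((x : ℂ) ^ (β - 1) * g x) * he

end SubstantialCalculus

/-! ### Choice of parameters and assembly of the error estimate -/

open SubstantialCalculus
theorem theorem4p13 (α : ℝ) (β : ℂ) (p : ℕ)
    (hβ : 0 ≤ α → ∀ k : ℕ, β ≠ -(k : ℂ)) (hαβ : α < 0 → (⌈-α⌉ : ℝ) < β.re) :
    ∃ N r : ℕ, ∀ (σ : ℝ) (ω : ℕ → ℂ), IsConvergentOfOrder σ α ω p →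
      ∃ w : ℝ → ℕ → ℕ → ℂ,
        (∀ h : ℝ, 0 < h → ∀ n : ℕ, 1 ≤ n → StartingSystem σ α β ω r (w h) h n) ∧
        ∀ g : ℝ → ℂ, ContDiffOn ℝ N g (Set.Ici 0) →
          SubstOpExists σ α (fun x => (x : ℂ) ^ (β - 1) * g x) ∧
          ∀ X : ℝ, 0 < X → ∃ C : ℝ, ∀ h : ℝ, 0 < h → ∀ n : ℕ, 1 ≤ n → n * h ≤ X →
            ‖correctedQuad σ α ω r (w h) h n (fun x => (x : ℂ) ^ (β - 1) * g x) -
              substOp σ α (fun x => (x : ℂ) ^ (β - 1) * g x) (n * h)‖ ≤ C * h ^ p := by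
  have hβ' : ∀ k : ℕ, β ≠ -(k : ℂ) := by
    rcases le_or_gt 0 α with hα | hα
    · exact hβ hα
    · intro k hk
      have h1 := (Int.le_ceil (-α)).trans_lt (hαβ hα)
      rw [hk, Complex.neg_re, Complex.natCast_re] at h1
      linarith [k.cast_nonneg (α := ℝ)]
  have hz : ∀ q k : ℕ, (q : ℂ) + β ≠ -(k : ℂ) := fun q k e =>
    hβ' (k + q) (by push_cast; linear_combination e)
  obtain ⟨K, hK⟩ : ∃ K : ℕ, (p : ℝ) ≤ α + K ∧ p ≤ K + 1 ∧ K ≠ 0 ∧ derivOrder (-α) ≤ K + 1 := by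
    obtain ⟨a, ha⟩ := exists_nat_ge (p - α)
    refine ⟨a + p + derivOrder (-α) + 1, ?_, by omega, by omega, by omega⟩
    push_cast
    have h1 : (0 : ℝ) ≤ p := p.cast_nonneg
    have h2 : (0 : ℝ) ≤ derivOrder (-α) := Nat.cast_nonneg _
    linarith
  obtain ⟨hpα, hpK, hK0, hKα⟩ := hK
  -- The first two conditions make the remainder `F` of class `C^(K+1)`; the last makes the growth
  -- exponent of the starting weights non-negative.
  obtain ⟨r, hr1, hr2, hr3⟩ : ∃ r : ℕ, K + 1 ≤ r ∧ ((K + 1 : ℕ) : ℝ) < (β - 1).re + r ∧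
      (p : ℝ) + 2 ≤ r + β.re + α := by
    obtain ⟨a, ha⟩ := exists_nat_gt (((K + 1 : ℕ) : ℝ) - (β - 1).re)
    obtain ⟨b, hb⟩ := exists_nat_ge ((p : ℝ) + 2 - β.re - α)
    refine ⟨K + 1 + a + b, by omega, ?_, ?_⟩
    · push_cast at ha ⊢
      linarith [b.cast_nonneg (α := ℝ), K.cast_nonneg (α := ℝ)]
    · push_cast
      linarith [a.cast_nonneg (α := ℝ), K.cast_nonneg (α := ℝ)]
  refine ⟨r, r, fun σ ω hω => ?_⟩
  obtain ⟨B, hB⟩ := exists_inverse_power_matrix β r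
  -- The starting weights for `σ = 0`, independent of `h`; the exponential factor is restored in
  -- `w`.
  set v : ℕ → ℕ → ℂ := fun n j =>
    ∑ i ∈ Finset.range r, B j i * -powerError α ω (i + β) n with hv
  have hvq : ∀ n, ∀ q < r, ∑ j ∈ Finset.Icc 1 r, v n j * (j : ℂ) ^ ((q : ℂ) + β - 1) =
      -powerError α ω (q + β) n := fun n q hq => hB (fun i => -powerError α ω (i + β) n) q hq
  set w : ℝ → ℕ → ℕ → ℂ := fun h n j => (Real.exp (-σ * (n * h - j * h)) : ℂ) * v n j with hw
  have hwe : ∀ h n j, w h n j * (Real.exp (-σ * (j * h)) : ℂ) =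
      (Real.exp (-σ * (n * h)) : ℂ) * v n j := fun h n j => by
    have : Real.exp (-σ * (n * h)) = Real.exp (-σ * (n * h - j * h)) * Real.exp (-σ * (j * h)) := by
      rw [← Real.exp_add]
      congr 1
      ring
    rw [hw, this]
    push_cast
    ring
  refine ⟨w, fun h hh n hn q hq => ?_, fun g hg => ?_⟩
  · have h1 : ∑ j ∈ Finset.range (n + 1), convWeight σ ω h (n - j) *
        (Real.exp (-σ * (j * h)) : ℂ) * (j : ℂ) ^ ((q : ℂ) + β - 1) =
        (Real.exp (-σ * (n * h)) : ℂ) *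
          ∑ j ∈ Finset.range (n + 1), ω (n - j) * (j : ℂ) ^ ((q : ℂ) + β - 1) := by
      rw [Finset.mul_sum]
      refine Finset.sum_congr rfl fun j hj => ?_
      rw [convWeight_mul_exp σ ω h (Nat.lt_succ_iff.1 (Finset.mem_range.1 hj)), mul_assoc]
    have h2 : ∑ j ∈ Finset.Icc 1 r, w h n j * (Real.exp (-σ * (j * h)) : ℂ) *
        (j : ℂ) ^ ((q : ℂ) + β - 1) =
        (Real.exp (-σ * (n * h)) : ℂ) * -powerError α ω (q + β) n := by
      rw [← hvq n q hq, Finset.mul_sum]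
      refine Finset.sum_congr rfl fun j _ => ?_
      rw [hwe, mul_assoc]
    rw [h2, h1, powerError, show (α : ℂ) + q + β = q + β + α by ring,
      show (q : ℂ) + α + β - 1 = q + β + α - 1 by ring]
    ring
  · obtain ⟨c, R, hR, hf⟩ := exists_cpow_mul_eq_sum_add hβ' σ (by omega : r ≠ 0) hg
    set F := cpowMulPos (β - 1) R with hFdef
    have hF : ContDiff ℝ (K + 1 : ℕ) F := contDiff_cpowMulPos hr1 hR hr2
    have hF0 : ∀ x ≤ 0, F x = 0 := fun x hx => cpowMulPos_of_nonpos hx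
    obtain ⟨hex, hop⟩ := substOp_eq (s := Finset.range r) (c := c) (z := fun q => (q : ℂ) + β)
      (fun q _ => hz q) (by omega : 1 ≤ K + 1) hKα hF hF0 (σ := σ)
      (f := fun x => (x : ℂ) ^ (β - 1) * g x) (fun x hx => hf x hx.le)
    refine ⟨hex, fun X hX => ?_⟩
    obtain ⟨C₁, hC₁0, hC₁⟩ := exists_norm_rpow_mul_sum_sub_rlIntegral_le hω hK0 hpK hpα hF hF0 X
    obtain ⟨CF, hCF0, hCF⟩ := exists_norm_cpowMulPos_le hR (β - 1) (r * X)
    have hre : (β - 1).re = β.re - 1 := by simp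
    rw [hre] at hCF hr2
    have hK1 : (p : ℝ) ≤ ((K + 1 : ℕ) : ℝ) := by exact_mod_cast hpK
    have hp0 : (0 : ℝ) ≤ p := p.cast_nonneg
    -- The exponent is the one produced by the highest power `i = r - 1`; by the choice of `r` it
    -- also dominates `α - 1`.
    have hvb : ∃ Cv, 0 ≤ Cv ∧ ∀ n : ℕ, 1 ≤ n → ∀ j ∈ Finset.Icc 1 r,
        ‖v n j‖ ≤ Cv * (n : ℝ) ^ (α + β.re + r - 2 - p) := by
      choose D hD0 hD using fun q : ℕ => exists_norm_powerError_le hω (hz q)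
      refine ⟨∑ j ∈ Finset.Icc 1 r, ∑ i ∈ Finset.range r, ‖B j i‖ * (D i * 2),
        Finset.sum_nonneg fun j _ => Finset.sum_nonneg fun i _ => by have := hD0 i; positivity,
        fun n hn j hj => ?_⟩
      have hn1 : (1 : ℝ) ≤ n := by exact_mod_cast hn
      have h1 : ‖v n j‖ ≤ (∑ i ∈ Finset.range r, ‖B j i‖ * (D i * 2)) *
          (n : ℝ) ^ (α + β.re + r - 2 - p) := by
        rw [hv, Finset.sum_mul]
        refine (norm_sum_le _ _).trans (Finset.sum_le_sum fun i hi => ?_)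
        have hir : (i : ℝ) + 1 ≤ r := by exact_mod_cast Finset.mem_range.1 hi
        rw [norm_mul, norm_neg, mul_assoc]
        refine mul_le_mul_of_nonneg_left ((hD i n hn).trans ?_) (norm_nonneg _)
        rw [mul_assoc]
        refine mul_le_mul_of_nonneg_left ?_ (hD0 i)
        have h2 : (n : ℝ) ^ (α - 1) ≤ (n : ℝ) ^ (α + β.re + r - 2 - p) :=
          Real.rpow_le_rpow_of_exponent_le hn1 (by linarith)
        have h3 : (n : ℝ) ^ (α + ((i : ℂ) + β).re - 1 - p) ≤ (n : ℝ) ^ (α + β.re + r - 2 - p) :=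
          Real.rpow_le_rpow_of_exponent_le hn1 (by
            rw [Complex.add_re, Complex.natCast_re]; linarith)
        linarith
      refine h1.trans (mul_le_mul_of_nonneg_right ?_ (by positivity))
      exact Finset.single_le_sum (f := fun j => ∑ i ∈ Finset.range r, ‖B j i‖ * (D i * 2))
        (fun j _ => Finset.sum_nonneg fun i _ => by have := hD0 i; positivity) hj
    obtain ⟨Cv, hCv0, hCv⟩ := hvb
    obtain ⟨C₂, hC₂0, hC₂⟩ := exists_norm_rpow_mul_sum_weights_le (α := α) (p := p)
      (E := α + β.re + r - 2 - p) (e := β.re - 1 + r) (by linarith) (by ring) hCv0 hCF0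
      (by linarith) hCv hCF
    refine ⟨Real.exp (|σ| * X) * (C₁ + C₂), fun h hh n hn hnX => ?_⟩
    have hn0 : (0 : ℝ) < n := by exact_mod_cast hn
    have hx : 0 < n * h := by positivity
    set u : ℝ → ℂ := fun x =>
      ∑ q ∈ Finset.range r, c q * (x : ℂ) ^ ((q : ℂ) + β - 1) + F x with hu
    have hfu : ∀ j : ℕ, (fun x : ℝ => (x : ℂ) ^ (β - 1) * g x) (j * h) =
        (Real.exp (-σ * (j * h)) : ℂ) * u (j * h) := fun j => hf (j * h) (by positivity)
    have hcorr : ((h ^ α : ℝ) : ℂ) * ∑ j ∈ Finset.Icc 1 r,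
        w h n j * (fun x : ℝ => (x : ℂ) ^ (β - 1) * g x) (j * h) =
        (Real.exp (-σ * (n * h)) : ℂ) *
          (((h ^ α : ℝ) : ℂ) * ∑ j ∈ Finset.Icc 1 r, v n j * u (j * h)) := by
      rw [mul_left_comm, Finset.mul_sum _ _ (Real.exp _ : ℂ)]
      congr 1
      refine Finset.sum_congr rfl fun j _ => ?_
      rw [hfu, ← mul_assoc, hwe, mul_assoc]
    -- Exactness on the powers: the correction contributes exactly minus the power error.
    have hpowers : ((h ^ α : ℝ) : ℂ) * ∑ j ∈ Finset.range (n + 1), ω (n - j) *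
          ∑ q ∈ Finset.range r, c q * ((j * h : ℝ) : ℂ) ^ ((q : ℂ) + β - 1) +
        ((h ^ α : ℝ) : ℂ) * ∑ j ∈ Finset.Icc 1 r, v n j *
          ∑ q ∈ Finset.range r, c q * ((j * h : ℝ) : ℂ) ^ ((q : ℂ) + β - 1) =
        ∑ q ∈ Finset.range r, c q * (Complex.Gamma (q + β) / Complex.Gamma (q + β + α)) *
          ((n * h : ℝ) : ℂ) ^ ((q : ℂ) + β + α - 1) := by
      have hswap : ∀ (t : Finset ℕ) (a : ℕ → ℂ), ((h ^ α : ℝ) : ℂ) * ∑ j ∈ t, a j *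
          ∑ q ∈ Finset.range r, c q * ((j * h : ℝ) : ℂ) ^ ((q : ℂ) + β - 1) =
          ∑ q ∈ Finset.range r, c q * (((h ^ α : ℝ) : ℂ) *
            ∑ j ∈ t, a j * ((j * h : ℝ) : ℂ) ^ ((q : ℂ) + β - 1)) := fun t a => by
        simp only [Finset.mul_sum]
        rw [Finset.sum_comm]
        exact Finset.sum_congr rfl fun q _ => Finset.sum_congr rfl fun j _ => by ring
      rw [hswap, hswap, ← Finset.sum_add_distrib]
      refine Finset.sum_congr rfl fun q hq => ?_
      have h1 := rpow_mul_sum_sub_eq_powerError hh α ω (q + β) n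
      have h2 : ((h ^ α : ℝ) : ℂ) * ∑ j ∈ Finset.Icc 1 r,
          v n j * ((j * h : ℝ) : ℂ) ^ ((q : ℂ) + β - 1) =
          (h : ℂ) ^ ((q : ℂ) + β + α - 1) * -powerError α ω (q + β) n := by
        rw [← hvq n q (Finset.mem_range.1 hq), Finset.mul_sum, Finset.mul_sum]
        refine Finset.sum_congr rfl fun j _ => ?_
        rw [mul_left_comm, ofReal_rpow_mul_cpow hh]
        ring
      rw [h2]
      linear_combination c q * h1
    have herr : correctedQuad σ α ω r (w h) h n (fun x => (x : ℂ) ^ (β - 1) * g x) -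
        substOp σ α (fun x => (x : ℂ) ^ (β - 1) * g x) (n * h) =
        (Real.exp (-σ * (n * h)) : ℂ) *
          ((((h ^ α : ℝ) : ℂ) * ∑ j ∈ Finset.range (n + 1), ω (n - j) * F (j * h) -
            rlIntegral (α + (K + 1 : ℕ)) (iteratedDeriv (K + 1) F) (n * h)) +
          ((h ^ α : ℝ) : ℂ) * ∑ j ∈ Finset.Icc 1 r, v n j * F (j * h)) := by
      rw [correctedQuad, hop _ hx, convQuad_eq hfu, hcorr, ← hpowers]
      simp only [hu, mul_add, Finset.sum_add_distrib]
      ring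
    rw [herr, norm_mul, Complex.norm_real, Real.norm_of_nonneg (Real.exp_pos _).le, mul_assoc]
    refine mul_le_mul ?_ ?_ (norm_nonneg _) (Real.exp_pos _).le
    · refine Real.exp_le_exp.2 (mul_le_mul (neg_le_abs σ) hnX hx.le (abs_nonneg σ))
    · rw [add_mul]
      exact (norm_add_le _ _).trans (add_le_add (hC₁ h hh n hn hnX) (hC₂ h hh n hn hnX))
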